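/- Let $n\ge 1$ and $\mathcal H=L^2(\mathbb R^n)$, with canonical observables $R=(Q_1,P_1,\dots,Q_n,P_n)$, where $Q_j$ is multiplication by $x_j$ and $P_j=-i\partial_j$, and with Weyl operators $V(z)=\exp\big(i\sum_j(q_jP_j-p_jQ_j)\big)$, $z=(q_1,p_1,\dots,q_n,p_n)\in\mathbb R^{2n}$. A state is a positive semidefinite trace class operator $\rho$ on $\mathcal H$ with $\operatorname{Tr}\rho=1$; its characteristic function is $\chi_\rho(z)=\operatorname{Tr}(\rho V(z))$ and its Wigner function is $W_\rho(u)=(2\pi)^{-n}\int_{\mathbb R^{2n}}e^{-i(u,z)}\chi_\rho(z)\,dz$. It is a Schwartz state if $\chi_\rho$ is a Schwartz function on $\mathbb R^{2n}$. Let $\mathcal L$ be the generator of the quantum diffusion semigroup on the trace class operators on $\mathcal H$, that is, the closure in trace norm of $$-\tfrac14\sum_{k=1}^{2n}[R_k,[R_k,\,\cdot\,]]\quad\text{on}\quad \operatorname{span}\Big\{|\varphi\rangle\langle\psi| : \varphi,\psi\in C^2(\mathbb R^n)\cap\bigcap_{k=1}^{2n}\operatorname{dom}(R_k^2)\Big\},$$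 and for $\rho\in\operatorname{dom}(\mathcal L)$ let $\mathcal E(\rho)=-\operatorname{Tr}(\rho\,\mathcal L(\rho))$ be the Dirichlet form. Let $\|\rho\|_2=(\operatorname{Tr}|\rho|^2)^{1/2}$ be the Hilbert–Schmidt norm. Theorem (non-commutative Nash inequality). For every $n\ge1$ there is a constant $C_n>0$, depending only on $n$, such that for every Schwartz state $\rho$ on $L^2(\mathbb R^n)$ whose Wigner function is nonnegative, one has $\rho\in\operatorname{dom}(\mathcal L)$, the number $\mathcal E(\rho)$ is real, and $$\|\rho\|_2^{2+2/n}\le C_n\,\mathcal E(\rho).$$ -/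

import Mathlib

open MeasureTheory Filter Topology
open scoped ENNReal InnerProductSpace ComplexOrder

noncomputable section

namespace QuantumDiffusion

/-! ### Traces and Schatten norms on a Hilbert space -/

section Trace

variable {H : Type*} [NormedAddCommGroup H] [InnerProductSpace ℂ H] [CompleteSpace H]

/-- Index set of a fixed orthonormal basis of `H`. -/
def basisSet (H : Type*) [NormedAddCommGroup H] [InnerProductSpace ℂ H] [CompleteSpace H] :
    Set H :=
  (exists_hilbertBasis ℂ H).choose

/-- A fixed orthonormal (Hilbert) basis of `H`, used to compute traces. The traces below do not
depend on this choice (for positive operators, resp. for trace class operators). -/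
def onb (H : Type*) [NormedAddCommGroup H] [InnerProductSpace ℂ H] [CompleteSpace H] :
    HilbertBasis (basisSet H) ℂ H :=
  (exists_hilbertBasis ℂ H).choose_spec.choose

/-- The trace, in `[0, ∞]`, of a positive operator. -/
def posTrace (A : H →L[ℂ] H) : ℝ≥0∞ :=
  ∑' i, ENNReal.ofReal (⟪onb H i, A (onb H i)⟫_ℂ).re

/-- The Schatten one-norm (trace norm) `‖A‖₁ = Tr |A|`. -/
def traceNorm (A : H →L[ℂ] H) : ℝ≥0∞ :=
  posTrace (CFC.abs A)

/-- The Hilbert-Schmidt norm `‖A‖₂ = (Tr |A|²)^(1/2)`. -/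
def hsNorm (A : H →L[ℂ] H) : ℝ≥0∞ :=
  posTrace (CFC.abs A ^ 2) ^ (1 / 2 : ℝ)

/-- `A` is a trace class operator. -/
def IsTraceClass (A : H →L[ℂ] H) : Prop :=
  traceNorm A < ∞

/-- The (complex) trace of a trace class operator. -/
def tr (A : H →L[ℂ] H) : ℂ :=
  ∑' i, ⟪onb H i, A (onb H i)⟫_ℂ

/-- States (density matrices): positive semidefinite trace class operators of trace one. -/
structure IsState (ρ : H →L[ℂ] H) : Prop where
  isPositive : ρ.IsPositive
  isTraceClass : IsTraceClass ρ
  tr_eq_one : tr ρ = 1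

end Trace

/-! ### Phase space and the Weyl operators in the Schrödinger representation -/

/-- The configuration space `ℝⁿ`. -/
abbrev Config (n : ℕ) : Type := EuclideanSpace ℝ (Fin n)

/-- The Hilbert space `L²(ℝⁿ)` of `n` modes. -/
abbrev Hilb (n : ℕ) : Type := Lp ℂ 2 (volume : Measure (Config n))

/-- Bounded operators on `L²(ℝⁿ)`. -/
abbrev Op (n : ℕ) : Type := Hilb n →L[ℂ] Hilb n

/-- The phase space `ℝ²ⁿ`; for a point `z` of it, `z (inl j)` is the coordinate `q_j` and
`z (inr j)` is the coordinate `p_j`. -/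
abbrev Phase (n : ℕ) : Type := EuclideanSpace ℝ (Fin n ⊕ Fin n)

variable {n : ℕ}

/-- The position part `q` of a phase space point `(q, p)`. -/
def qPart (z : Phase n) : Config n := WithLp.toLp 2 fun j => z (Sum.inl j)

/-- The momentum part `p` of a phase space point `(q, p)`. -/
def pPart (z : Phase n) : Config n := WithLp.toLp 2 fun j => z (Sum.inr j)

/-- The unimodular factor `exp (-i p·x - i p·q / 2)`. -/
def weylPhase (z : Phase n) (x : Config n) : ℂ :=
  Complex.exp (-Complex.I * ((⟪pPart z, x⟫_ℝ + ⟪pPart z, qPart z⟫_ℝ / 2 : ℝ) : ℂ))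

lemma norm_weylPhase (z : Phase n) (x : Config n) : ‖weylPhase z x‖ = 1 := by
  rw [weylPhase, neg_mul, mul_comm, ← neg_mul, ← Complex.ofReal_neg]
  exact Complex.norm_exp_ofReal_mul_I _

lemma continuous_weylPhase (z : Phase n) : Continuous (weylPhase z) := by
  unfold weylPhase
  fun_prop

/-- Multiplication by `weylPhase z`. -/
lemma memLp_weylPhase_mul (z : Phase n) (ψ : Hilb n) :
    MemLp (fun x => weylPhase z x * ψ x) 2 (volume : Measure (Config n)) := by
  refine (Lp.memLp ψ).of_le
    ((continuous_weylPhase z).aestronglyMeasurable.mul (Lp.aestronglyMeasurable ψ)) ?_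
  exact Eventually.of_forall fun x => by simp [norm_weylPhase]

/-- The unitary operator of multiplication by `weylPhase z`. -/
def phaseMul (z : Phase n) : Op n :=
  LinearMap.mkContinuous
    { toFun := fun ψ => (memLp_weylPhase_mul z ψ).toLp _
      map_add' := fun ψ φ => by
        rw [← MemLp.toLp_add (memLp_weylPhase_mul z ψ) (memLp_weylPhase_mul z φ)]
        apply MemLp.toLp_congr
        filter_upwards [Lp.coeFn_add ψ φ] with x hx
        simp only [hx, Pi.add_apply, mul_add]
      map_smul' := fun c ψ => by
        rw [RingHom.id_apply, ← MemLp.toLp_const_smul]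
        apply MemLp.toLp_congr
        filter_upwards [Lp.coeFn_smul c ψ] with x hx
        simp [hx, mul_left_comm] }
    1 (fun ψ => by
      rw [one_mul]
      refine Lp.norm_le_norm_of_ae_le ?_
      filter_upwards [(memLp_weylPhase_mul z ψ).coeFn_toLp] with x hx
      change ‖((memLp_weylPhase_mul z ψ).toLp _ : Config n → ℂ) x‖ ≤ _
      rw [hx]
      simp [norm_weylPhase])

/-- The unitary translation `ψ ↦ ψ(· + a)`. -/
def translation (a : Config n) : Op n :=
  (Lp.compMeasurePreservingₗᵢ ℂ (fun x : Config n => x + a)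
    (measurePreserving_add_right volume a)).toContinuousLinearMap

/-- The Weyl operator `V(z) = exp (i ∑ⱼ (qⱼ Pⱼ - pⱼ Qⱼ))`, `z = (q, p)`, in the Schrödinger
representation, that is, `(V(q, p) ψ)(x) = exp (-i p·x - i p·q / 2) ψ(x + q)`. -/
def weyl (z : Phase n) : Op n :=
  phaseMul z * translation (qPart z)

lemma weyl_apply_ae (z : Phase n) (ψ : Hilb n) :
    (weyl z ψ : Config n → ℂ) =ᵐ[volume] fun x => weylPhase z x * ψ (x + qPart z) := by
  have h1 := (memLp_weylPhase_mul z (translation (qPart z) ψ)).coeFn_toLp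
  have h2 : (translation (qPart z) ψ : Config n → ℂ) =ᵐ[volume]
      fun x => ψ (x + qPart z) :=
    Lp.coeFn_compMeasurePreserving ψ (measurePreserving_add_right volume (qPart z))
  filter_upwards [h1, h2] with x hx1 hx2
  rw [← hx2]
  exact hx1

/-! ### Characteristic function, Wigner function, Schwartz states -/

/-- The quantum characteristic function `χ_ρ(z) = Tr (ρ V(z))`. -/
def charFun (ρ : Op n) (z : Phase n) : ℂ :=
  tr (ρ * weyl z)

/-- The Wigner function `W_ρ(u) = (2π)⁻ⁿ ∫ exp (-i (u, z)) χ_ρ(z) dz`. -/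
def wigner (ρ : Op n) (u : Phase n) : ℂ :=
  ((2 * Real.pi : ℝ) ^ n : ℂ)⁻¹ *
    ∫ z : Phase n, Complex.exp (-Complex.I * ((⟪u, z⟫_ℝ : ℝ) : ℂ)) * charFun ρ z

/-- A Schwartz state: a state whose characteristic function is a Schwartz function. -/
structure IsSchwartzState (ρ : Op n) : Prop where
  isState : IsState ρ
  schwartz : ∃ f : SchwartzMap (Phase n) ℂ, ∀ z, charFun ρ z = f z

/-- The Wigner function is real and nonnegative everywhere (the order on `ℂ` is the one for which
`0 ≤ w` means that `w` is real and nonnegative). -/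
def HasPositiveWigner (ρ : Op n) : Prop :=
  ∀ u, 0 ≤ wigner ρ u

/-! ### Canonical observables -/

/-- The phase space direction whose Weyl group is generated by the observable `R_k`: the group of
`Q_j` is `V(-t p⁽ʲ⁾)` and that of `P_j` is `V(t q⁽ʲ⁾)`. -/
def genDir : Fin n ⊕ Fin n → Phase n
  | Sum.inl j => -EuclideanSpace.single (Sum.inr j) 1
  | Sum.inr j => EuclideanSpace.single (Sum.inl j) 1

/-- `ψ` lies in the domain of the self-adjoint (Stone) generator `R_k` of the unitary group
`t ↦ V(t genDir k)`; here `R_(inl j) = Q_j` and `R_(inr j) = P_j`. -/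
def InDomR (k : Fin n ⊕ Fin n) (ψ : Hilb n) : Prop :=
  DifferentiableAt ℝ (fun t : ℝ => weyl (t • genDir k) ψ) 0

/-- The observable `R_k` (meaningful on its domain): `R_k ψ = -i (d/dt) V(t genDir k) ψ` at
`t = 0`. -/
def obsR (k : Fin n ⊕ Fin n) (ψ : Hilb n) : Hilb n :=
  (-Complex.I) • deriv (fun t : ℝ => weyl (t • genDir k) ψ) 0

/-- `S` is the bounded operator given by the commutator `[R_k, T]`: for every `φ` in the (dense)
domain of `R_k`, the vector `T φ` is in that domain too and `S φ = R_k T φ - T R_k φ`. -/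
def IsCommutator (k : Fin n ⊕ Fin n) (T S : Op n) : Prop :=
  ∀ φ, InDomR k φ → InDomR k (T φ) ∧ S φ = obsR k (T φ) - T (obsR k φ)

/-! ### The generator of the quantum diffusion semigroup -/

/-- The intersection over all `k` of the domains of `R_k²`, consisting (as is required for the
`P_j²`) of functions with a `C²` representative. -/
def vectorDomain (n : ℕ) : Set (Hilb n) :=
  {φ | (∃ f : Config n → ℂ, ContDiff ℝ 2 f ∧ (φ : Config n → ℂ) =ᵐ[volume] f) ∧
    ∀ k, InDomR k φ ∧ InDomR k (obsR k φ)}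

/-- The initial domain `D = span {|φ⟩⟨ψ|}` of the generator, `φ`, `ψ` in `vectorDomain n`. -/
def initialDomain (n : ℕ) : Submodule ℂ (Op n) :=
  Submodule.span ℂ
    {T | ∃ φ ∈ vectorDomain n, ∃ ψ ∈ vectorDomain n, T = InnerProductSpace.rankOne ℂ φ ψ}

/-- The graph of `T ↦ -(1/4) ∑ₖ [R_k, [R_k, T]]` on the initial domain. -/
def InitialGenerator (T U : Op n) : Prop :=
  T ∈ initialDomain n ∧
    ∃ S W : Fin n ⊕ Fin n → Op n,
      (∀ k, IsCommutator k T (S k) ∧ IsCommutator k (S k) (W k)) ∧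
      U = (-(1 / 4) : ℂ) • ∑ k, W k

/-- The graph of the generator `ℒ`: the closure, with respect to the trace norm, of the graph of
`-(1/4) ∑ₖ [R_k, [R_k, ·]]` on the initial domain, inside pairs of trace class operators. -/
def GeneratorGraph (ρ σ : Op n) : Prop :=
  IsTraceClass ρ ∧ IsTraceClass σ ∧
    ∃ T U : ℕ → Op n, (∀ m, InitialGenerator (T m) (U m)) ∧
      Tendsto (fun m => traceNorm (T m - ρ)) atTop (𝓝 0) ∧
      Tendsto (fun m => traceNorm (U m - σ)) atTop (𝓝 0)

/-- The domain of the generator `ℒ` of the quantum diffusion semigroup. -/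
def generatorDomain (n : ℕ) : Set (Op n) :=
  {ρ | ∃ σ, GeneratorGraph ρ σ}

open Classical in
/-- The generator `ℒ`. For `ρ` in its domain, the operator `σ` with `GeneratorGraph ρ σ` is unique,
as the symmetric operator on the initial domain is closable; the value outside the domain
is irrelevant. -/
def generator (ρ : Op n) : Op n :=
  if h : ∃ σ, GeneratorGraph ρ σ then h.choose else 0

/-- The Dirichlet form `ℰ(ρ) = -Tr (ρ ℒ(ρ))`. -/
def dirichletForm (ρ : Op n) : ℂ :=
  -tr (ρ * generator ρ)

end QuantumDiffusion

end

/-! Everything is read off from characteristic functions. On them the generator acts as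
multiplication by `-‖z‖²/4` (`GeneratorGraph.charFun_eq`), and Plancherel's theorem
`integral_conj_charFun_mul_charFun` says that `∫ conj χ_A χ_B = (2π)ⁿ Tr (A* B)`. Hence `(2π)ⁿ ‖ρ‖₂²
= ∫ |χ|²` and `(2π)ⁿ ℰ(ρ) = (1/4) ∫ ‖z‖² |χ|²`, with `|χ| ≤ 1` because `ρ` has trace norm one.
Nash's argument then applies: `|χ|² ≤ 1` on the ball of radius `R` and `|χ|² ≤ R⁻² ‖z‖² |χ|²` off
it, so `∫ |χ|² ≤ w R²ⁿ + R⁻² ∫ ‖z‖² |χ|²` with `w` the volume of the unit ball, and a suitable `R`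
gives the inequality.

The other half is that a Schwartz state lies in the domain of the generator. Write `ρ = ∑ |aᵢ⟩⟨aᵢ|`
with `aᵢ = √ρ eᵢ`. Along the direction `g` of `R_k`, the function `t ↦ χ(t g)` is the correlation
function of the curve `t ↦ (V(t g) aᵢ)ᵢ` in `ℓ²`. A `C²` correlation function makes the curve
differentiable, and the derivative has correlation function `-c''`; so four derivatives of `χ` give
two of the curve, that is, `aᵢ ∈ dom (R_k²)` with `‖R_k aᵢ‖` and `‖R_k² aᵢ‖` square summable
(`IsExpansion.inDomR_and_summable`). The double commutator series then converges in trace norm.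
Finite partial sums are reached from the initial domain by mollifying each `aᵢ`
(`exists_seq_vectorDomain`).

Trace class theory rests on strongly convergent expansions `A = ∑ |aⱼ⟩⟨bⱼ|`: the trace norm is the
least value of `∑ ‖aⱼ‖ ‖bⱼ‖`. -/

noncomputable section

set_option linter.unusedSectionVars false

namespace QuantumDiffusion

/-! ### Trace class operators through rank-one expansions -/

section TraceTheory

variable {H : Type*} [NormedAddCommGroup H] [InnerProductSpace ℂ H] [CompleteSpace H]

lemma norm_abs_apply (A : H →L[ℂ] H) (x : H) : ‖CFC.abs A x‖ = ‖A x‖ := by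
  have hsa : IsSelfAdjoint (CFC.abs A) := (CFC.abs_nonneg A).isSelfAdjoint
  have h1 : ⟪CFC.abs A x, CFC.abs A x⟫_ℂ = ⟪A x, A x⟫_ℂ := by
    rw [← ContinuousLinearMap.adjoint_inner_right, ← ContinuousLinearMap.adjoint_inner_right A,
      ← ContinuousLinearMap.star_eq_adjoint, ← ContinuousLinearMap.star_eq_adjoint, hsa.star_eq]
    have := congrArg (fun T : H →L[ℂ] H => ⟪x, T x⟫_ℂ) (CFC.abs_mul_abs A)
    simpa using this
  rw [inner_self_eq_norm_sq_to_K, inner_self_eq_norm_sq_to_K] at h1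
  have h2 : ‖CFC.abs A x‖ ^ 2 = ‖A x‖ ^ 2 := by exact_mod_cast h1
  exact (sq_eq_sq₀ (norm_nonneg _) (norm_nonneg _)).1 h2

/-- Polar decomposition of a bounded operator. -/
lemma exists_polar_decomposition (A : H →L[ℂ] H) :
    ∃ U : H →L[ℂ] H, ‖U‖ ≤ 1 ∧ A = U * CFC.abs A ∧
      CFC.abs A = ContinuousLinearMap.adjoint U * A := by
  set K : Submodule ℂ H := (CFC.abs A).range.topologicalClosure with hK
  have hmem : ∀ x, CFC.abs A x ∈ K := fun x =>
    Submodule.le_topologicalClosure _ (LinearMap.mem_range_self _ x)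
  let e : H →ₗ[ℂ] K := (CFC.abs A).toLinearMap.codRestrict K hmem
  have hdense : DenseRange e := by
    intro y
    rw [closure_subtype]
    have hy : (y : H) ∈ closure ((CFC.abs A).range : Set H) := y.2
    refine closure_mono ?_ hy
    rintro _ ⟨x, rfl⟩
    exact ⟨e x, ⟨x, rfl⟩, rfl⟩
  have hnorm : ∀ x, ‖A.toLinearMap x‖ ≤ 1 * ‖e x‖ := fun x => by
    rw [one_mul]
    exact (norm_abs_apply A x).symm.le
  -- The map `|A| x ↦ A x` is isometric on the range of `|A|`; it extends to the closure `K` and is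
  -- then precomposed with the orthogonal projection onto `K`.
  let f : K →L[ℂ] H := A.toLinearMap.extendOfNorm e
  have hf : ‖f‖ ≤ 1 := LinearMap.opNorm_extendOfNorm_le hdense zero_le_one hnorm
  let U : H →L[ℂ] H := f.comp K.orthogonalProjectionOnto
  have hU : ‖U‖ ≤ 1 := (f.opNorm_comp_le _).trans
    (mul_le_one₀ hf (norm_nonneg _) (K.orthogonalProjectionOnto_norm_le))
  have hA : ∀ x, U (CFC.abs A x) = A x := fun x => by
    have h1 : K.orthogonalProjectionOnto (CFC.abs A x) = e x :=
      K.orthogonalProjectionOnto_mem_subspace_eq_self (e x)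
    change f (K.orthogonalProjectionOnto (CFC.abs A x)) = A x
    rw [h1]
    exact LinearMap.extendOfNorm_eq hdense ⟨1, hnorm⟩ x
  refine ⟨U, hU, ?_, ?_⟩
  · ext x
    exact (hA x).symm
  · ext x
    change CFC.abs A x = ContinuousLinearMap.adjoint U (A x)
    rw [← hA x]
    set r := CFC.abs A x with hr
    have hUr : ‖U r‖ = ‖r‖ := by rw [hA x, hr, norm_abs_apply]
    have hle : ‖ContinuousLinearMap.adjoint U (U r)‖ ≤ ‖r‖ := by
      refine (ContinuousLinearMap.le_opNorm _ _).trans ?_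
      rw [hUr, LinearIsometryEquiv.norm_map]
      exact mul_le_of_le_one_left (norm_nonneg _) hU
    -- Since `‖U r‖ = ‖r‖`, expanding the square gives `‖r‖² - 2‖U r‖² + ‖U* U r‖² ≤ 0`.
    have h2 : ‖r - ContinuousLinearMap.adjoint U (U r)‖ ^ 2 ≤ 0 := by
      rw [@norm_sub_sq ℂ, ContinuousLinearMap.adjoint_inner_right, inner_self_eq_norm_sq, hUr]
      nlinarith [norm_nonneg (ContinuousLinearMap.adjoint U (U r)), norm_nonneg r]
    have h3 : ‖r - ContinuousLinearMap.adjoint U (U r)‖ = 0 :=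
      pow_eq_zero_iff two_ne_zero |>.1 (le_antisymm h2 (sq_nonneg _))
    exact sub_eq_zero.1 (norm_eq_zero.1 h3)

/-- Cauchy–Schwarz over finite index sets, then Bessel's inequality for each factor. -/
lemma tsum_enorm_inner_mul_le (a b : H) :
    ∑' i, ‖⟪onb H i, a⟫_ℂ‖ₑ * ‖⟪b, onb H i⟫_ℂ‖ₑ ≤ ‖a‖ₑ * ‖b‖ₑ := by
  rw [ENNReal.tsum_eq_iSup_sum]
  refine iSup_le fun s => ?_
  have h : ∑ i ∈ s, ‖⟪onb H i, a⟫_ℂ‖ * ‖⟪b, onb H i⟫_ℂ‖ ≤ ‖a‖ * ‖b‖ := by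
    refine (Real.sum_mul_le_sqrt_mul_sqrt _ _ _).trans ?_
    refine mul_le_mul ?_ ?_ (Real.sqrt_nonneg _) (norm_nonneg _)
    · exact Real.sqrt_le_iff.2 ⟨norm_nonneg _, (onb H).orthonormal.sum_inner_products_le a⟩
    · refine Real.sqrt_le_iff.2 ⟨norm_nonneg _, ?_⟩
      simp_rw [norm_inner_symm b]
      exact (onb H).orthonormal.sum_inner_products_le b
  simp_rw [← ofReal_norm, ← ENNReal.ofReal_mul (norm_nonneg _)]
  rw [← ENNReal.ofReal_sum_of_nonneg fun i _ => by positivity]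
  exact ENNReal.ofReal_le_ofReal h

/-- The expansion `A = ∑ⱼ |aⱼ⟩⟨bⱼ|`, strongly convergent. -/
def IsExpansion {ι : Type*} (A : H →L[ℂ] H) (a b : ι → H) : Prop :=
  ∀ x, HasSum (fun j => ⟪b j, x⟫_ℂ • a j) (A x)

variable {ι κ : Type*} {A B : H →L[ℂ] H} {a b : ι → H}

lemma IsExpansion.mul_left (h : IsExpansion A a b) (W : H →L[ℂ] H) :
    IsExpansion (W * A) (fun j => W (a j)) b := fun x => by
  simpa using (h x).mapL W

lemma IsExpansion.mul_right (h : IsExpansion A a b) (W : H →L[ℂ] H) :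
    IsExpansion (A * W) a (fun j => ContinuousLinearMap.adjoint W (b j)) := fun x => by
  simpa [ContinuousLinearMap.adjoint_inner_left] using h (W x)

lemma IsExpansion.add (h : IsExpansion A a b) {c d : κ → H} (h' : IsExpansion B c d) :
    IsExpansion (A + B) (Sum.elim a c) (Sum.elim b d) := fun x =>
  HasSum.sum (by simpa [Function.comp_def] using h x) (by simpa [Function.comp_def] using h' x)

lemma IsExpansion.smul (h : IsExpansion A a b) (c : ℂ) :
    IsExpansion (c • A) (fun j => c • a j) b := fun x => by
  simpa [smul_comm c] using (h x).const_smul c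

lemma isExpansion_rankOne (φ ψ : H) :
    IsExpansion (InnerProductSpace.rankOne ℂ φ ψ) (fun _ : Unit => φ) (fun _ => ψ) := fun x => by
  exact hasSum_unique (fun _ : Unit => ⟪ψ, x⟫_ℂ • φ)

lemma IsExpansion.tsum_enorm_le (h : IsExpansion A a b) :
    ∑' i, ‖⟪onb H i, A (onb H i)⟫_ℂ‖ₑ ≤ ∑' j, ‖a j‖ₑ * ‖b j‖ₑ := by
  calc ∑' i, ‖⟪onb H i, A (onb H i)⟫_ℂ‖ₑ
      ≤ ∑' i, ∑' j, ‖⟪onb H i, a j⟫_ℂ‖ₑ * ‖⟪b j, onb H i⟫_ℂ‖ₑ := by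
        refine ENNReal.tsum_le_tsum fun i => ?_
        have h1 := (h (onb H i)).mapL (innerSL ℂ (onb H i))
        simp only [innerSL_apply_apply, inner_smul_right] at h1
        rw [← h1.tsum_eq]
        refine (enorm_tsum_le_tsum_enorm).trans (ENNReal.tsum_le_tsum fun j => ?_)
        rw [enorm_mul, mul_comm]
    _ = ∑' j, ∑' i, ‖⟪onb H i, a j⟫_ℂ‖ₑ * ‖⟪b j, onb H i⟫_ℂ‖ₑ := ENNReal.tsum_comm
    _ ≤ _ := ENNReal.tsum_le_tsum fun j => tsum_enorm_inner_mul_le _ _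

lemma summable_of_tsum_enorm_lt_top {α E : Type*} [NormedAddCommGroup E] [CompleteSpace E]
    {f : α → E} (h : ∑' i, ‖f i‖ₑ < ∞) : Summable f := by
  have h1 : Summable fun i => ‖f i‖₊ := ENNReal.tsum_coe_ne_top_iff_summable.1 h.ne
  exact Summable.of_norm (NNReal.summable_coe.2 h1)

/-- The double family indexed by terms and basis vectors is absolutely summable, so its two iterated
sums agree. This computes traces without reference to the fixed basis. -/
lemma IsExpansion.hasSum_tr (h : IsExpansion A a b) (hs : ∑' j, ‖a j‖ₑ * ‖b j‖ₑ < ∞) :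
    HasSum (fun j => ⟪b j, a j⟫_ℂ) (tr A) := by
  have hF : Summable fun p : ι × basisSet H =>
      ⟪b p.1, onb H p.2⟫_ℂ * ⟪onb H p.2, a p.1⟫_ℂ := by
    apply summable_of_tsum_enorm_lt_top
    rw [ENNReal.tsum_prod']
    refine lt_of_le_of_lt (ENNReal.tsum_le_tsum fun j => ?_) hs
    simp_rw [enorm_mul, mul_comm (‖⟪b j, _⟫_ℂ‖ₑ)]
    exact tsum_enorm_inner_mul_le _ _
  have h1 : ∀ j, HasSum (fun i => ⟪b j, onb H i⟫_ℂ * ⟪onb H i, a j⟫_ℂ) ⟪b j, a j⟫_ℂ :=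
    fun j => (onb H).hasSum_inner_mul_inner _ _
  have h2 : ∀ i, HasSum (fun j => ⟪b j, onb H i⟫_ℂ * ⟪onb H i, a j⟫_ℂ)
      ⟪onb H i, A (onb H i)⟫_ℂ := fun i => by
    simpa [inner_smul_right] using (h (onb H i)).mapL (innerSL ℂ (onb H i))
  have h3 := hF.hasSum.prod_fiberwise h1
  have h4 := ((Equiv.prodComm _ _).hasSum_iff.2 hF.hasSum).prod_fiberwise h2
  rwa [← h4.tsum_eq] at h3

lemma ofReal_re_le_enorm (z : ℂ) : ENNReal.ofReal z.re ≤ ‖z‖ₑ := by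
  rw [← ofReal_norm]
  exact ENNReal.ofReal_le_ofReal (Complex.re_le_norm z)

lemma enorm_apply_le_of_norm_le_one {U : H →L[ℂ] H} (hU : ‖U‖ ≤ 1) (x : H) :
    ‖U x‖ₑ ≤ ‖x‖ₑ := by
  simp_rw [← ofReal_norm]
  exact ENNReal.ofReal_le_ofReal ((U.le_opNorm x).trans
    (mul_le_of_le_one_left (norm_nonneg _) hU))

/-- By polar decomposition `|A| = U* A` has the expansion `(U* aⱼ, bⱼ)`, whose terms are no larger.
Together with `exists_isExpansion` this characterises the trace norm as a minimum over expansions;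
the triangle inequality and the ideal property follow by manipulating expansions. -/
lemma IsExpansion.traceNorm_le (h : IsExpansion A a b) :
    traceNorm A ≤ ∑' j, ‖a j‖ₑ * ‖b j‖ₑ := by
  obtain ⟨U, hU, -, hA⟩ := exists_polar_decomposition A
  have h1 := (h.mul_left (ContinuousLinearMap.adjoint U)).tsum_enorm_le
  rw [← hA] at h1
  refine (ENNReal.tsum_le_tsum fun i => ofReal_re_le_enorm _).trans (h1.trans ?_)
  refine ENNReal.tsum_le_tsum fun j => ?_
  gcongr
  exact enorm_apply_le_of_norm_le_one (by rwa [LinearIsometryEquiv.norm_map]) _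

lemma isExpansion_sqrt (hA : 0 ≤ A) :
    IsExpansion A (fun i => CFC.sqrt A (onb H i)) (fun i => CFC.sqrt A (onb H i)) := fun x => by
  have hsa : IsSelfAdjoint (CFC.sqrt A) := (CFC.sqrt_nonneg A).isSelfAdjoint
  have h1 := ((onb H).hasSum_repr (CFC.sqrt A x)).mapL (CFC.sqrt A)
  have h2 : CFC.sqrt A (CFC.sqrt A x) = A x := by
    have := congrArg (fun T : H →L[ℂ] H => T x) (CFC.sqrt_mul_sqrt_self A hA)
    simpa using this
  rw [h2] at h1
  convert h1 using 1
  ext i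
  rw [map_smul, HilbertBasis.repr_apply_apply, ← ContinuousLinearMap.adjoint_inner_right,
    ← ContinuousLinearMap.star_eq_adjoint, hsa.star_eq]

lemma posTrace_eq_tsum_sqrt (hA : 0 ≤ A) :
    posTrace A = ∑' i, ‖CFC.sqrt A (onb H i)‖ₑ ^ 2 := by
  have hsa : IsSelfAdjoint (CFC.sqrt A) := (CFC.sqrt_nonneg A).isSelfAdjoint
  refine tsum_congr fun i => ?_
  have h2 : A (onb H i) = CFC.sqrt A (CFC.sqrt A (onb H i)) := by
    have := congrArg (fun T : H →L[ℂ] H => T (onb H i)) (CFC.sqrt_mul_sqrt_self A hA)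
    simpa using this.symm
  rw [h2, ← ContinuousLinearMap.adjoint_inner_left, ← ContinuousLinearMap.star_eq_adjoint,
    hsa.star_eq, inner_self_eq_norm_sq_to_K, ← ofReal_norm,
    ← ENNReal.ofReal_pow (norm_nonneg _)]
  norm_cast

/-- Every bounded operator has an expansion realising its trace norm. -/
lemma exists_isExpansion (A : H →L[ℂ] H) :
    ∃ a b : basisSet H → H, IsExpansion A a b ∧ ∑' j, ‖a j‖ₑ * ‖b j‖ₑ ≤ traceNorm A := by
  obtain ⟨U, hU, hA, -⟩ := exists_polar_decomposition A
  have h := (isExpansion_sqrt (CFC.abs_nonneg A)).mul_left U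
  rw [← hA] at h
  refine ⟨_, _, h, ?_⟩
  rw [traceNorm, posTrace_eq_tsum_sqrt (CFC.abs_nonneg A)]
  refine ENNReal.tsum_le_tsum fun j => ?_
  rw [pow_two]
  gcongr
  exact enorm_apply_le_of_norm_le_one hU _

lemma traceNorm_add_le (A B : H →L[ℂ] H) : traceNorm (A + B) ≤ traceNorm A + traceNorm B := by
  obtain ⟨a, b, h, hs⟩ := exists_isExpansion A
  obtain ⟨c, d, h', hs'⟩ := exists_isExpansion B
  refine (h.add h').traceNorm_le.trans ?_
  rw [ENNReal.summable.tsum_sum ENNReal.summable]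
  exact add_le_add hs hs'

lemma traceNorm_smul_le (c : ℂ) (A : H →L[ℂ] H) : traceNorm (c • A) ≤ ‖c‖ₑ * traceNorm A := by
  obtain ⟨a, b, h, hs⟩ := exists_isExpansion A
  refine (h.smul c).traceNorm_le.trans ?_
  simp_rw [enorm_smul, mul_assoc]
  rw [ENNReal.tsum_mul_left]
  gcongr

lemma traceNorm_neg (A : H →L[ℂ] H) : traceNorm (-A) = traceNorm A := by
  rw [traceNorm, CFC.abs_neg, traceNorm]

lemma traceNorm_zero : traceNorm (0 : H →L[ℂ] H) = 0 := by
  simp [traceNorm, posTrace]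

lemma traceNorm_sum_le {α : Type*} (s : Finset α) (A : α → H →L[ℂ] H) :
    traceNorm (∑ k ∈ s, A k) ≤ ∑ k ∈ s, traceNorm (A k) :=
  Finset.le_sum_of_subadditive _ traceNorm_zero.le traceNorm_add_le _ _

lemma IsTraceClass.add (hA : IsTraceClass A) (hB : IsTraceClass B) : IsTraceClass (A + B) :=
  (traceNorm_add_le A B).trans_lt (ENNReal.add_lt_top.2 ⟨hA, hB⟩)

lemma IsTraceClass.smul (hA : IsTraceClass A) (c : ℂ) : IsTraceClass (c • A) :=
  (traceNorm_smul_le c A).trans_lt (ENNReal.mul_lt_top enorm_lt_top hA)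

lemma IsTraceClass.sub (hA : IsTraceClass A) (hB : IsTraceClass B) : IsTraceClass (A - B) := by
  rw [sub_eq_add_neg]
  exact hA.add (by rwa [IsTraceClass, traceNorm_neg])

lemma isTraceClass_zero : IsTraceClass (0 : H →L[ℂ] H) := by
  rw [IsTraceClass, traceNorm_zero]; exact ENNReal.zero_lt_top

lemma isTraceClass_sum {α : Type*} (s : Finset α) (A : α → H →L[ℂ] H)
    (h : ∀ k ∈ s, IsTraceClass (A k)) : IsTraceClass (∑ k ∈ s, A k) :=
  Finset.sum_induction _ _ (fun _ _ => IsTraceClass.add) isTraceClass_zero h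

lemma traceNorm_rankOne_le (φ ψ : H) :
    traceNorm (InnerProductSpace.rankOne ℂ φ ψ) ≤ ‖φ‖ₑ * ‖ψ‖ₑ :=
  (isExpansion_rankOne φ ψ).traceNorm_le.trans (by simp)

lemma isTraceClass_rankOne (φ ψ : H) : IsTraceClass (InnerProductSpace.rankOne ℂ φ ψ) :=
  (traceNorm_rankOne_le φ ψ).trans_lt (ENNReal.mul_lt_top enorm_lt_top enorm_lt_top)

lemma traceNorm_mul_le (A W : H →L[ℂ] H) (hW : ‖W‖ ≤ 1) :
    traceNorm (A * W) ≤ traceNorm A := by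
  obtain ⟨a, b, h, hs⟩ := exists_isExpansion A
  refine (h.mul_right W).traceNorm_le.trans (le_trans (ENNReal.tsum_le_tsum fun j => ?_) hs)
  gcongr
  exact enorm_apply_le_of_norm_le_one (by rwa [LinearIsometryEquiv.norm_map]) _

lemma tsum_enorm_le_traceNorm (A : H →L[ℂ] H) :
    ∑' i, ‖⟪onb H i, A (onb H i)⟫_ℂ‖ₑ ≤ traceNorm A := by
  obtain ⟨a, b, h, hs⟩ := exists_isExpansion A
  exact h.tsum_enorm_le.trans hs

lemma enorm_tr_le (A : H →L[ℂ] H) : ‖tr A‖ₑ ≤ traceNorm A :=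
  enorm_tsum_le_tsum_enorm.trans (tsum_enorm_le_traceNorm A)

lemma IsTraceClass.summable (hA : IsTraceClass A) :
    Summable fun i => ⟪onb H i, A (onb H i)⟫_ℂ :=
  summable_of_tsum_enorm_lt_top ((tsum_enorm_le_traceNorm A).trans_lt hA)

lemma IsTraceClass.mul_right (hA : IsTraceClass A) {W : H →L[ℂ] H} (hW : ‖W‖ ≤ 1) :
    IsTraceClass (A * W) := (traceNorm_mul_le A W hW).trans_lt hA

lemma tr_add (hA : IsTraceClass A) (hB : IsTraceClass B) : tr (A + B) = tr A + tr B := by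
  simp only [tr]
  rw [← hA.summable.tsum_add hB.summable]
  simp

lemma tr_sub (hA : IsTraceClass A) (hB : IsTraceClass B) : tr (A - B) = tr A - tr B := by
  simp only [tr]
  rw [← hA.summable.tsum_sub hB.summable]
  simp

lemma tr_smul (c : ℂ) (A : H →L[ℂ] H) : tr (c • A) = c * tr A := by
  simp only [tr]
  rw [← tsum_mul_left]
  simp

lemma tr_rankOne (φ ψ : H) : tr (InnerProductSpace.rankOne ℂ φ ψ) = ⟪ψ, φ⟫_ℂ := by
  have h := (isExpansion_rankOne φ ψ).hasSum_tr (by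
    simpa using ENNReal.mul_lt_top (enorm_lt_top (x := φ)) (enorm_lt_top (x := ψ)))
  exact (h.unique (hasSum_unique (fun _ : Unit => ⟪ψ, φ⟫_ℂ)))

end TraceTheory

end QuantumDiffusion

/-! ### Weyl operators: unitarity, strong continuity, commutation relations -/

namespace QuantumDiffusion

variable {n : ℕ}

@[simp] lemma qPart_add (z w : Phase n) : qPart (z + w) = qPart z + qPart w := rfl
@[simp] lemma pPart_add (z w : Phase n) : pPart (z + w) = pPart z + pPart w := rfl
@[simp] lemma qPart_smul (t : ℝ) (z : Phase n) : qPart (t • z) = t • qPart z := rfl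
@[simp] lemma pPart_smul (t : ℝ) (z : Phase n) : pPart (t • z) = t • pPart z := rfl
@[simp] lemma qPart_zero : qPart (0 : Phase n) = 0 := rfl
@[simp] lemma pPart_zero : pPart (0 : Phase n) = 0 := rfl
lemma continuous_qPart : Continuous (qPart : Phase n → Config n) := by
  unfold qPart; fun_prop

lemma continuous_pPart : Continuous (pPart : Phase n → Config n) := by
  unfold pPart; fun_prop

lemma continuous_weylPhase_uncurry :
    Continuous fun y : Phase n × Config n => weylPhase y.1 y.2 := by
  have := (continuous_qPart (n := n))
  have := (continuous_pPart (n := n))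
  unfold weylPhase
  fun_prop

lemma phaseMul_apply_ae (z : Phase n) (ψ : Hilb n) :
    (phaseMul z ψ : Config n → ℂ) =ᵐ[volume] fun x => weylPhase z x * ψ x :=
  (memLp_weylPhase_mul z ψ).coeFn_toLp

lemma norm_translation (a : Config n) (ψ : Hilb n) : ‖translation a ψ‖ = ‖ψ‖ :=
  LinearIsometry.norm_map _ ψ

lemma norm_phaseMul (z : Phase n) (ψ : Hilb n) : ‖phaseMul z ψ‖ = ‖ψ‖ := by
  rw [Lp.norm_def, Lp.norm_def]
  congr 1
  refine eLpNorm_congr_norm_ae ?_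
  filter_upwards [phaseMul_apply_ae z ψ] with x hx
  rw [hx, norm_mul, norm_weylPhase, one_mul]

lemma norm_weyl_apply (z : Phase n) (ψ : Hilb n) : ‖weyl z ψ‖ = ‖ψ‖ := by
  change ‖phaseMul z (translation (qPart z) ψ)‖ = _
  rw [norm_phaseMul, norm_translation]

lemma norm_weyl_le (z : Phase n) : ‖weyl z‖ ≤ 1 :=
  ContinuousLinearMap.opNorm_le_bound _ zero_le_one fun ψ => by
    rw [norm_weyl_apply, one_mul]

/-- The Weyl operators as linear isometries. -/
def weylIsometry (z : Phase n) : Hilb n →ₗᵢ[ℂ] Hilb n where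
  toLinearMap := (weyl z).toLinearMap
  norm_map' := norm_weyl_apply z

lemma inner_weyl_weyl (z : Phase n) (φ ψ : Hilb n) :
    ⟪weyl z φ, weyl z ψ⟫_ℂ = ⟪φ, ψ⟫_ℂ :=
  (weylIsometry z).inner_map_map φ ψ

/-- For vectors of equal norm, `‖f a - x‖² = 2‖x‖² - 2 Re ⟪x, f a⟫`, so convergence against `x`
alone forces norm convergence. -/
lemma tendsto_of_norm_eq_of_tendsto_inner {α E : Type*} [NormedAddCommGroup E]
    [InnerProductSpace ℂ E] {l : Filter α} {f : α → E} {x : E} (hf : ∀ a, ‖f a‖ = ‖x‖)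
    (h : Tendsto (fun a => ⟪x, f a⟫_ℂ) l (𝓝 ⟪x, x⟫_ℂ)) : Tendsto f l (𝓝 x) := by
  rw [tendsto_iff_norm_sub_tendsto_zero]
  have h1 : Tendsto (fun a => 2 * ‖x‖ ^ 2 - 2 * (⟪x, f a⟫_ℂ).re) l (𝓝 0) := by
    have h2 := (Complex.continuous_re.tendsto _).comp h
    have h3 := (h2.const_mul 2).const_sub (2 * ‖x‖ ^ 2)
    have h5 : (0 : ℝ) = 2 * ‖x‖ ^ 2 - 2 * (⟪x, x⟫_ℂ).re := by
      change (0 : ℝ) = 2 * ‖x‖ ^ 2 - 2 * RCLike.re ⟪x, x⟫_ℂ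
      rw [inner_self_eq_norm_sq]; ring
    rw [h5]
    exact h3
  have h4 : Tendsto (fun a => Real.sqrt (‖f a - x‖ ^ 2)) l (𝓝 (Real.sqrt 0)) := by
    refine (Real.continuous_sqrt.tendsto _).comp (h1.congr fun a => ?_)
    rw [@norm_sub_sq ℂ, hf, inner_re_symm]
    change _ = ‖x‖ ^ 2 - 2 * (⟪x, f a⟫_ℂ).re + ‖x‖ ^ 2
    ring
  simpa [Real.sqrt_sq (norm_nonneg _)] using h4

lemma inner_phaseMul_phaseMul (z w : Phase n) (φ ψ : Hilb n) :
    ⟪phaseMul z φ, phaseMul w ψ⟫_ℂ =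
      ∫ x, (starRingEnd ℂ) (weylPhase z x * φ x) * (weylPhase w x * ψ x) := by
  rw [L2.inner_def]
  refine integral_congr_ae ?_
  filter_upwards [phaseMul_apply_ae z φ, phaseMul_apply_ae w ψ] with x h1 h2
  rw [h1, h2, RCLike.inner_apply, mul_comm]

lemma integrable_norm_mul_norm (φ ψ : Hilb n) :
    Integrable (fun x => ‖φ x‖ * ‖ψ x‖) (volume : Measure (Config n)) :=
  MemLp.integrable_mul (p := 2) (q := 2) (Lp.memLp φ).norm (Lp.memLp ψ).norm

lemma continuous_phaseMul_apply (ψ : Hilb n) : Continuous fun z : Phase n => phaseMul z ψ := by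
  rw [continuous_iff_continuousAt]
  intro z₀
  refine tendsto_of_norm_eq_of_tendsto_inner (fun z => by simp [norm_phaseMul]) ?_
  simp_rw [inner_phaseMul_phaseMul]
  refine (continuous_of_dominated (F := fun z x => (starRingEnd ℂ) (weylPhase z₀ x * ψ x) *
    (weylPhase z x * ψ x)) (bound := fun x => ‖ψ x‖ * ‖ψ x‖) ?_ ?_
    (integrable_norm_mul_norm ψ ψ) ?_).tendsto z₀
  · intro z
    have h1 := Lp.aestronglyMeasurable ψ
    have h2 := (continuous_weylPhase z).aestronglyMeasurable (μ := volume)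
    have h3 := (continuous_weylPhase z₀).aestronglyMeasurable (μ := volume)
    exact (RCLike.continuous_conj.comp_aestronglyMeasurable (h3.mul h1)).mul (h2.mul h1)
  · intro z
    refine Eventually.of_forall fun x => ?_
    simp [norm_weylPhase]
  · refine Eventually.of_forall fun x => ?_
    have := (continuous_weylPhase_uncurry (n := n)).comp
      (continuous_id.prodMk (continuous_const (y := x)))
    simp only [Function.comp_def, id] at this
    fun_prop

lemma continuous_translation_apply (ψ : Hilb n) :
    Continuous fun a : Config n => translation a ψ := by
  have hg : Continuous fun a : Config n => (⟨fun x : Config n => x + a, by fun_prop⟩ :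
      C(Config n, Config n)) :=
    ContinuousMap.continuous_of_continuous_uncurry _ (by
      simp only [Function.uncurry_def, ContinuousMap.coe_mk]; fun_prop)
  exact Continuous.compMeasurePreservingLp (continuous_const (y := ψ)) hg
    (fun a => measurePreserving_add_right volume a) (by simp)

/-- Strong continuity of the Weyl operators. -/
lemma continuous_weyl_apply (ψ : Hilb n) : Continuous fun z : Phase n => weyl z ψ := by
  rw [continuous_iff_continuousAt]
  intro z₀
  have h1 : Tendsto (fun z : Phase n => translation (qPart z) ψ) (𝓝 z₀)
      (𝓝 (translation (qPart z₀) ψ)) :=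
    ((continuous_translation_apply ψ).comp continuous_qPart).tendsto z₀
  have h2 := (continuous_phaseMul_apply (translation (qPart z₀) ψ)).tendsto z₀
  -- Only one factor moves at a time; the isometry `phaseMul z` drops out of this difference, which
  -- makes the estimate uniform in `z`.
  have h3 : Tendsto (fun z : Phase n => phaseMul z (translation (qPart z) ψ) -
      phaseMul z (translation (qPart z₀) ψ)) (𝓝 z₀) (𝓝 0) := by
    rw [tendsto_zero_iff_norm_tendsto_zero]
    simp_rw [← map_sub, norm_phaseMul]
    exact tendsto_iff_norm_sub_tendsto_zero.1 h1
  have h4 := h3.add h2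
  simp only [sub_add_cancel, zero_add] at h4
  exact h4

/-- The symplectic form on phase space. -/
def symp (z w : Phase n) : ℝ := ⟪pPart z, qPart w⟫_ℝ - ⟪pPart w, qPart z⟫_ℝ

lemma weyl_weyl_apply (z w : Phase n) (ψ : Hilb n) :
    weyl z (weyl w ψ) = Complex.exp (Complex.I * ((symp z w / 2 : ℝ) : ℂ)) • weyl (z + w) ψ := by
  apply Lp.ext
  have h := (measurePreserving_add_right volume (qPart z)).quasiMeasurePreserving.ae
    (weyl_apply_ae w ψ)
  filter_upwards [weyl_apply_ae z (weyl w ψ), h, weyl_apply_ae (z + w) ψ,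
    Lp.coeFn_smul (Complex.exp (Complex.I * ((symp z w / 2 : ℝ) : ℂ))) (weyl (z + w) ψ)]
    with x h1 h2 h3 h4
  rw [h1, h2, h4, Pi.smul_apply, h3, smul_eq_mul, ← mul_assoc, ← mul_assoc]
  simp only [weylPhase, ← Complex.exp_add, qPart_add, pPart_add, symp, add_assoc]
  congr 2
  simp only [inner_add_left, inner_add_right]
  push_cast
  ring

lemma weyl_zero : weyl (0 : Phase n) = 1 := by
  ext1 ψ
  apply Lp.ext
  filter_upwards [weyl_apply_ae 0 ψ] with x hx
  simp [hx, weylPhase]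

lemma symp_smul_smul (s t : ℝ) (z : Phase n) : symp (s • z) (t • z) = 0 := by
  simp [symp, inner_smul_left, inner_smul_right]; ring

/-- The symplectic form vanishes on a line, so the cocycle disappears and `t ↦ V(t z)` is a genuine
one-parameter group. -/
lemma weyl_smul_smul (s t : ℝ) (z : Phase n) (ψ : Hilb n) :
    weyl (s • z) (weyl (t • z) ψ) = weyl ((s + t) • z) ψ := by
  rw [weyl_weyl_apply, symp_smul_smul, ← add_smul]
  simp

lemma weyl_neg_weyl (z : Phase n) (ψ : Hilb n) : weyl (-z) (weyl z ψ) = ψ := by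
  have := weyl_smul_smul (-1) 1 z ψ
  simpa [weyl_zero] using this

lemma weyl_weyl_neg (z : Phase n) (ψ : Hilb n) : weyl z (weyl (-z) ψ) = ψ := by
  simpa using weyl_neg_weyl (-z) ψ

lemma inner_weyl_right (z : Phase n) (φ ψ : Hilb n) :
    ⟪φ, weyl z ψ⟫_ℂ = ⟪weyl (-z) φ, ψ⟫_ℂ := by
  rw [← inner_weyl_weyl z (weyl (-z) φ), weyl_weyl_neg]

lemma symp_swap (z w : Phase n) : symp z w = -symp w z := by
  simp [symp]

/-- The Weyl form of the canonical commutation relations. -/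
lemma weyl_comm_apply (z w : Phase n) (ψ : Hilb n) :
    weyl z (weyl w ψ) = Complex.exp (Complex.I * (symp z w : ℂ)) • weyl w (weyl z ψ) := by
  rw [weyl_weyl_apply, weyl_weyl_apply, smul_smul, ← Complex.exp_add, add_comm w z,
    symp_swap w z]
  congr 2
  push_cast
  ring

/-- The signs in `genDir` are such that pairing with it reads off the coordinate `z k`; this is why
commutation with `R_k` becomes multiplication by `z k`. -/
lemma symp_smul_genDir (k : Fin n ⊕ Fin n) (t : ℝ) (z : Phase n) :
    symp z (t • genDir k) = t * z k := by
  cases k with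
  | inl j =>
    simp only [symp, qPart_smul, pPart_smul, inner_smul_left, inner_smul_right]
    have h1 : qPart (genDir (Sum.inl j) : Phase n) = 0 := by ext i; simp [qPart, genDir]
    have h2 : pPart (genDir (Sum.inl j) : Phase n) = -EuclideanSpace.single j 1 := by
      ext i; simp [pPart, genDir]
    rw [h1, h2]
    simp [qPart, EuclideanSpace.inner_single_left]
  | inr j =>
    simp only [symp, qPart_smul, pPart_smul, inner_smul_left, inner_smul_right]
    have h1 : pPart (genDir (Sum.inr j) : Phase n) = 0 := by ext i; simp [pPart, genDir]
    have h2 : qPart (genDir (Sum.inr j) : Phase n) = EuclideanSpace.single j 1 := by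
      ext i; simp [qPart, genDir]
    rw [h1, h2]
    simp [pPart, EuclideanSpace.inner_single_right]

lemma weyl_weyl_genDir (z : Phase n) (k : Fin n ⊕ Fin n) (t : ℝ) (ψ : Hilb n) :
    weyl z (weyl (t • genDir k) ψ) =
      Complex.exp (Complex.I * ((t * z k : ℝ) : ℂ)) • weyl (t • genDir k) (weyl z ψ) := by
  rw [weyl_comm_apply, symp_smul_genDir]

/-! ### Domains of the canonical observables -/

lemma InDomR.hasDerivAt {k : Fin n ⊕ Fin n} {ψ : Hilb n} (h : InDomR k ψ) :
    HasDerivAt (fun t : ℝ => weyl (t • genDir k) ψ) (Complex.I • obsR k ψ) 0 := by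
  have h1 : Complex.I • obsR k ψ = deriv (fun t : ℝ => weyl (t • genDir k) ψ) 0 := by
    rw [obsR, smul_smul]; simp
  rw [h1]
  exact DifferentiableAt.hasDerivAt h

lemma inDomR_of_hasDerivAt {k : Fin n ⊕ Fin n} {ψ χ : Hilb n}
    (h : HasDerivAt (fun t : ℝ => weyl (t • genDir k) ψ) (Complex.I • χ) 0) :
    InDomR k ψ ∧ obsR k ψ = χ := by
  refine ⟨h.differentiableAt, ?_⟩
  rw [obsR, h.deriv, smul_smul]; simp

lemma InDomR.hasDerivAt' {k : Fin n ⊕ Fin n} {ψ : Hilb n} (h : InDomR k ψ) (t : ℝ) :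
    HasDerivAt (fun t : ℝ => weyl (t • genDir k) ψ)
      (Complex.I • weyl (t • genDir k) (obsR k ψ)) t := by
  have h1 : HasDerivAt (fun s : ℝ => weyl ((s - t) • genDir k) ψ) (Complex.I • obsR k ψ) t := by
    have := HasDerivAt.comp_sub_const (x := t) (a := t) (f := fun s : ℝ => weyl (s • genDir k) ψ)
      (f' := Complex.I • obsR k ψ) (by simpa using h.hasDerivAt)
    exact this
  have h2 := ((weyl (t • genDir k)).restrictScalars ℝ).hasFDerivAt.comp_hasDerivAt t h1
  simp only [ContinuousLinearMap.coe_restrictScalars', Function.comp_def, weyl_smul_smul,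
    add_sub_cancel, map_smul] at h2
  exact h2

lemma InDomR.add_smul {k : Fin n ⊕ Fin n} {φ ψ : Hilb n} (hφ : InDomR k φ) (hψ : InDomR k ψ)
    (c d : ℂ) : InDomR k (c • φ + d • ψ) ∧
      obsR k (c • φ + d • ψ) = c • obsR k φ + d • obsR k ψ := by
  apply inDomR_of_hasDerivAt
  have := (hφ.hasDerivAt.const_smul c).add (hψ.hasDerivAt.const_smul d)
  simp only [smul_add, smul_comm Complex.I]
  refine this.congr_of_eventuallyEq (Eventually.of_forall fun t => ?_)
  simp

lemma InDomR.smul {k : Fin n ⊕ Fin n} {φ : Hilb n} (hφ : InDomR k φ) (c : ℂ) :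
    InDomR k (c • φ) ∧ obsR k (c • φ) = c • obsR k φ := by
  simpa using hφ.add_smul hφ c 0

lemma InDomR.add {k : Fin n ⊕ Fin n} {φ ψ : Hilb n} (hφ : InDomR k φ) (hψ : InDomR k ψ) :
    InDomR k (φ + ψ) ∧ obsR k (φ + ψ) = obsR k φ + obsR k ψ := by
  simpa using hφ.add_smul hψ 1 1

/-- The observables are symmetric. -/
lemma inner_obsR_left {k : Fin n ⊕ Fin n} {φ ψ : Hilb n} (hφ : InDomR k φ) (hψ : InDomR k ψ) :
    ⟪obsR k φ, ψ⟫_ℂ = ⟪φ, obsR k ψ⟫_ℂ := by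
  have h := hφ.hasDerivAt.inner ℂ hψ.hasDerivAt
  simp only [inner_weyl_weyl, zero_smul, weyl_zero] at h
  -- The paired curve is constant by unitarity, so its derivative at `0` vanishes.
  have h0 := h.unique (hasDerivAt_const (0 : ℝ) ⟪φ, ψ⟫_ℂ)
  simp only [one_apply_eq_self, inner_smul_left, inner_smul_right, Complex.conj_I] at h0
  have h1 : Complex.I * (⟪φ, obsR k ψ⟫_ℂ - ⟪obsR k φ, ψ⟫_ℂ) = 0 := by
    rw [← h0]; ring
  have h2 := (mul_eq_zero.1 h1).resolve_left Complex.I_ne_zero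
  exact (sub_eq_zero.1 h2).symm

lemma continuous_weyl_smul (z : Phase n) (ψ : Hilb n) :
    Continuous fun t : ℝ => weyl (t • z) ψ :=
  (continuous_weyl_apply ψ).comp (by fun_prop)

/-- The domain of each observable is dense. -/
lemma dense_inDomR (k : Fin n ⊕ Fin n) : Dense {ψ : Hilb n | InDomR k ψ} := by
  intro φ
  -- Averages over an orbit lie in the domain, because the group acts on them by shifting the
  -- interval of integration; and `t⁻¹ F t → φ`.
  set F : ℝ → Hilb n := fun t => ∫ s in (0 : ℝ)..t, weyl (s • genDir k) φ with hF
  have hcont := continuous_weyl_smul (genDir k) φ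
  have hderiv : ∀ t, HasDerivAt F (weyl (t • genDir k) φ) t := fun t =>
    intervalIntegral.integral_hasDerivAt_right (hcont.intervalIntegrable _ _)
      hcont.aestronglyMeasurable.stronglyMeasurableAtFilter hcont.continuousAt
  have hdom : ∀ h : ℝ, InDomR k (F h) := fun h => by
    have h1 : ∀ t : ℝ, weyl (t • genDir k) (F h) = F (h + t) - F t := fun t => by
      rw [hF, intervalIntegral.integral_interval_sub_left (hcont.intervalIntegrable _ _)
        (hcont.intervalIntegrable _ _), ← ContinuousLinearMap.intervalIntegral_comp_comm _
        (hcont.intervalIntegrable _ _)]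
      simp_rw [weyl_smul_smul]
      rw [intervalIntegral.integral_comp_add_left (fun s => weyl (s • genDir k) φ)]
      simp [add_comm]
    have h2 : HasDerivAt (fun t => F (h + t) - F t) _ 0 :=
      ((hderiv (h + 0)).comp_const_add h 0).sub (hderiv 0)
    exact (h2.congr_of_eventuallyEq (Eventually.of_forall h1)).differentiableAt
  have hlim : Tendsto (fun t : ℝ => ((t⁻¹ : ℝ) : ℂ) • F t) (𝓝[≠] 0) (𝓝 φ) := by
    have := (hasDerivAt_iff_tendsto_slope_zero.1 (hderiv 0))
    refine Tendsto.congr (fun t => (algebraMap_smul ℂ t⁻¹ (F t)).symm) ?_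
    simpa [hF, weyl_zero] using this
  refine mem_closure_of_tendsto hlim (Eventually.of_forall fun t => ?_)
  exact ((hdom t).smul _).1

end QuantumDiffusion

namespace QuantumDiffusion

open InnerProductSpace (rankOne)

variable {n : ℕ}

/-! ### Commutators -/

/-- Bounded operators agreeing on the dense domain of `R_k` are equal. This identifies the
commutators supplied by `InitialGenerator` with the explicit rank-one ones. -/
lemma IsCommutator.unique {k : Fin n ⊕ Fin n} {T S S' : Op n} (h : IsCommutator k T S)
    (h' : IsCommutator k T S') : S = S' := by
  have : (S : Hilb n → Hilb n) = S' :=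
    Continuous.ext_on (dense_inDomR k) S.continuous S'.continuous fun φ hφ => by
      rw [(h φ hφ).2, (h' φ hφ).2]
  exact DFunLike.coe_injective this

lemma IsCommutator.add {k : Fin n ⊕ Fin n} {T S T' S' : Op n} (h : IsCommutator k T S)
    (h' : IsCommutator k T' S') : IsCommutator k (T + T') (S + S') := fun φ hφ => by
  obtain ⟨h1, h2⟩ := h φ hφ
  obtain ⟨h3, h4⟩ := h' φ hφ
  refine ⟨(h1.add h3).1, ?_⟩
  simp only [add_apply]
  rw [(h1.add h3).2, h2, h4]
  abel

lemma IsCommutator.smul {k : Fin n ⊕ Fin n} {T S : Op n} (h : IsCommutator k T S) (c : ℂ) :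
    IsCommutator k (c • T) (c • S) := fun φ hφ => by
  obtain ⟨h1, h2⟩ := h φ hφ
  refine ⟨(h1.smul c).1, ?_⟩
  simp only [smul_apply]
  rw [(h1.smul c).2, h2, smul_sub]

lemma isCommutator_zero (k : Fin n ⊕ Fin n) : IsCommutator k (0 : Op n) 0 := fun φ hφ => by
  have := hφ.smul 0
  simp only [zero_smul] at this
  simp [this.1, this.2]

lemma IsCommutator.sum {ι : Type*} {k : Fin n ⊕ Fin n} (s : Finset ι) {T S : ι → Op n}
    (h : ∀ i ∈ s, IsCommutator k (T i) (S i)) :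
    IsCommutator k (∑ i ∈ s, T i) (∑ i ∈ s, S i) := by
  classical
  induction s using Finset.induction_on with
  | empty => simpa using isCommutator_zero k
  | insert i s hi ih =>
    rw [Finset.sum_insert hi, Finset.sum_insert hi]
    exact (h i (Finset.mem_insert_self _ _)).add
      (ih fun j hj => h j (Finset.mem_insert_of_mem hj))

/-- The commutator of `R_k` with `|φ⟩⟨ψ|`. -/
def rankOneComm (k : Fin n ⊕ Fin n) (φ ψ : Hilb n) : Op n :=
  rankOne ℂ (obsR k φ) ψ - rankOne ℂ φ (obsR k ψ)

/-- The double commutator of `R_k` with `|φ⟩⟨ψ|`. -/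
def rankOneComm₂ (k : Fin n ⊕ Fin n) (φ ψ : Hilb n) : Op n :=
  rankOneComm k (obsR k φ) ψ - rankOneComm k φ (obsR k ψ)

lemma isCommutator_rankOne {k : Fin n ⊕ Fin n} {φ ψ : Hilb n} (hφ : InDomR k φ)
    (hψ : InDomR k ψ) : IsCommutator k (rankOne ℂ φ ψ) (rankOneComm k φ ψ) := fun x hx => by
  simp only [InnerProductSpace.rankOne_apply, rankOneComm, sub_apply]
  refine ⟨(hφ.smul _).1, ?_⟩
  rw [(hφ.smul _).2, inner_obsR_left hψ hx]

lemma IsCommutator.sub {k : Fin n ⊕ Fin n} {T S T' S' : Op n} (h : IsCommutator k T S)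
    (h' : IsCommutator k T' S') : IsCommutator k (T - T') (S - S') := by
  have := h.add (h'.smul (-1))
  simpa [sub_eq_add_neg] using this

lemma isCommutator_rankOneComm {k : Fin n ⊕ Fin n} {φ ψ : Hilb n} (hφ : InDomR k φ)
    (hφ' : InDomR k (obsR k φ)) (hψ : InDomR k ψ) (hψ' : InDomR k (obsR k ψ)) :
    IsCommutator k (rankOneComm k φ ψ) (rankOneComm₂ k φ ψ) :=
  (isCommutator_rankOne hφ' hψ).sub (isCommutator_rankOne hφ hψ')

/-! ### Characteristic functions -/

lemma isTraceClass_mul_weyl {A : Op n} (hA : IsTraceClass A) (z : Phase n) :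
    IsTraceClass (A * weyl z) := hA.mul_right (norm_weyl_le z)

lemma charFun_add {A B : Op n} (hA : IsTraceClass A) (hB : IsTraceClass B) (z : Phase n) :
    charFun (A + B) z = charFun A z + charFun B z := by
  rw [charFun, add_mul, tr_add (isTraceClass_mul_weyl hA z) (isTraceClass_mul_weyl hB z)]
  rfl

lemma charFun_sub {A B : Op n} (hA : IsTraceClass A) (hB : IsTraceClass B) (z : Phase n) :
    charFun (A - B) z = charFun A z - charFun B z := by
  rw [charFun, sub_mul, tr_sub (isTraceClass_mul_weyl hA z) (isTraceClass_mul_weyl hB z)]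
  rfl

lemma charFun_smul (c : ℂ) (A : Op n) (z : Phase n) :
    charFun (c • A) z = c * charFun A z := by
  rw [charFun, smul_mul_assoc, tr_smul]
  rfl

lemma charFun_zero (z : Phase n) : charFun (0 : Op n) z = 0 := by
  simp [charFun, tr]

lemma charFun_sum {ι : Type*} (s : Finset ι) {A : ι → Op n}
    (hA : ∀ i ∈ s, IsTraceClass (A i)) (z : Phase n) :
    charFun (∑ i ∈ s, A i) z = ∑ i ∈ s, charFun (A i) z := by
  classical
  induction s using Finset.induction_on with
  | empty => simp [charFun_zero]
  | insert i s hi ih =>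
    have hs : ∀ j ∈ s, IsTraceClass (A j) := fun j hj => hA j (Finset.mem_insert_of_mem hj)
    rw [Finset.sum_insert hi, Finset.sum_insert hi,
      charFun_add (hA i (Finset.mem_insert_self _ _)) (isTraceClass_sum s A hs), ih hs]

lemma enorm_charFun_le (A : Op n) (z : Phase n) : ‖charFun A z‖ₑ ≤ traceNorm A :=
  (enorm_tr_le _).trans (traceNorm_mul_le A _ (norm_weyl_le z))

lemma charFun_rankOne (φ ψ : Hilb n) (z : Phase n) :
    charFun (rankOne ℂ φ ψ) z = ⟪ψ, weyl z φ⟫_ℂ := by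
  have : rankOne ℂ φ ψ * weyl z = rankOne ℂ φ (ContinuousLinearMap.adjoint (weyl z) ψ) := by
    ext1 x
    simp [ContinuousLinearMap.adjoint_inner_left]
  rw [charFun, this, tr_rankOne, ContinuousLinearMap.adjoint_inner_left]

lemma isTraceClass_rankOneComm (k : Fin n ⊕ Fin n) (φ ψ : Hilb n) :
    IsTraceClass (rankOneComm k φ ψ) :=
  (isTraceClass_rankOne _ _).sub (isTraceClass_rankOne _ _)

lemma isTraceClass_rankOneComm₂ (k : Fin n ⊕ Fin n) (φ ψ : Hilb n) :
    IsTraceClass (rankOneComm₂ k φ ψ) :=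
  (isTraceClass_rankOneComm _ _ _).sub (isTraceClass_rankOneComm _ _ _)

/-- The function `t ↦ ⟪ψ, V(z) V(t g) φ⟫`, with `g = genDir k`, is differentiated at `0` in two
ways: directly on `φ`, and after moving `V(t g)` past `V(z)` and onto `ψ`, where the Weyl relation
contributes `exp (i t z_k)`. Comparison gives the factor `z k`. -/
lemma charFun_rankOneComm {k : Fin n ⊕ Fin n} {φ ψ : Hilb n} (hφ : InDomR k φ)
    (hψ : InDomR k ψ) (z : Phase n) :
    charFun (rankOneComm k φ ψ) z = z k * charFun (rankOne ℂ φ ψ) z := by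
  rw [rankOneComm, charFun_sub (isTraceClass_rankOne _ _) (isTraceClass_rankOne _ _)]
  simp only [charFun_rankOne]
  have h1 : HasDerivAt (fun t : ℝ => ⟪ψ, weyl z (weyl (t • genDir k) φ)⟫_ℂ)
      ⟪ψ, weyl z (Complex.I • obsR k φ)⟫_ℂ 0 := by
    have h := (((innerSL ℂ ψ).comp (weyl z)).restrictScalars ℝ).hasFDerivAt.comp_hasDerivAt
      (0 : ℝ) hφ.hasDerivAt
    exact h
  have hexp : HasDerivAt (fun t : ℝ => Complex.exp (Complex.I * ((t * z k : ℝ) : ℂ)))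
      (Complex.I * z k) 0 := by
    have h : HasDerivAt (fun t : ℝ => Complex.I * ((t * z k : ℝ) : ℂ))
        (Complex.I * ((1 * z k : ℝ) : ℂ)) 0 :=
      (((hasDerivAt_id (0 : ℝ)).mul_const (z k)).ofReal_comp).const_mul _
    simpa using h.cexp
  have hneg : HasDerivAt (fun t : ℝ => weyl ((-t) • genDir k) ψ) (-(Complex.I • obsR k ψ)) 0 := by
    have h := HasDerivAt.scomp (x := (0 : ℝ)) (h := fun t : ℝ => -t)
      (g₁ := fun t : ℝ => weyl (t • genDir k) ψ) (h' := -1)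
      (g₁' := Complex.I • obsR k ψ) (by simpa using hψ.hasDerivAt) (hasDerivAt_neg 0)
    simpa [Function.comp_def] using h
  have h2 := hexp.mul (hneg.inner ℂ (hasDerivAt_const (0 : ℝ) (weyl z φ)))
  have h3 : (fun t : ℝ => ⟪ψ, weyl z (weyl (t • genDir k) φ)⟫_ℂ) =
      (fun t : ℝ => Complex.exp (Complex.I * ((t * z k : ℝ) : ℂ))) *
        fun t : ℝ => ⟪weyl ((-t) • genDir k) ψ, weyl z φ⟫_ℂ := by
    ext t
    rw [weyl_weyl_genDir, inner_smul_right, inner_weyl_right (t • genDir k), ← neg_smul]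
    rfl
  rw [h3] at h1
  have h4 := h1.unique h2
  simp only [map_smul, inner_smul_right, zero_mul, Complex.ofReal_zero, mul_zero, Complex.exp_zero,
    neg_zero, zero_smul, weyl_zero, one_apply_eq_self, inner_zero_right, inner_neg_left,
    inner_smul_left, Complex.conj_I, zero_add, one_mul] at h4
  have h5 : Complex.I * (⟪ψ, weyl z (obsR k φ)⟫_ℂ - ⟪obsR k ψ, weyl z φ⟫_ℂ -
      z k * ⟪ψ, weyl z φ⟫_ℂ) = 0 := by
    rw [mul_sub, mul_sub, h4]; ring
  have h6 := (mul_eq_zero.1 h5).resolve_left Complex.I_ne_zero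
  exact sub_eq_zero.1 h6

lemma charFun_rankOneComm₂ {k : Fin n ⊕ Fin n} {φ ψ : Hilb n} (hφ : InDomR k φ)
    (hφ' : InDomR k (obsR k φ)) (hψ : InDomR k ψ) (hψ' : InDomR k (obsR k ψ)) (z : Phase n) :
    charFun (rankOneComm₂ k φ ψ) z = z k ^ 2 * charFun (rankOne ℂ φ ψ) z := by
  rw [rankOneComm₂, charFun_sub (isTraceClass_rankOneComm _ _ _) (isTraceClass_rankOneComm _ _ _),
    charFun_rankOneComm hφ' hψ, charFun_rankOneComm hφ hψ', ← mul_sub,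
    ← charFun_sub (isTraceClass_rankOne _ _) (isTraceClass_rankOne _ _)]
  change (z k : ℂ) * charFun (rankOneComm k φ ψ) z = _
  rw [charFun_rankOneComm hφ hψ]
  ring

lemma exists_commutators_of_mem_initialDomain {T : Op n} (hT : T ∈ initialDomain n) :
    IsTraceClass T ∧ ∃ S W : Fin n ⊕ Fin n → Op n, ∀ k,
      IsCommutator k T (S k) ∧ IsCommutator k (S k) (W k) ∧ IsTraceClass (W k) ∧
        ∀ z, charFun (W k) z = z k ^ 2 * charFun T z := by
  induction hT using Submodule.span_induction with
  | mem T h =>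
    obtain ⟨φ, hφ, ψ, hψ, rfl⟩ := h
    exact ⟨isTraceClass_rankOne _ _, fun k => rankOneComm k φ ψ, fun k => rankOneComm₂ k φ ψ,
      fun k => ⟨isCommutator_rankOne (hφ.2 k).1 (hψ.2 k).1,
        isCommutator_rankOneComm (hφ.2 k).1 (hφ.2 k).2 (hψ.2 k).1 (hψ.2 k).2,
        isTraceClass_rankOneComm₂ _ _ _,
        charFun_rankOneComm₂ (hφ.2 k).1 (hφ.2 k).2 (hψ.2 k).1 (hψ.2 k).2⟩⟩
  | zero =>
    exact ⟨isTraceClass_zero, 0, 0, fun k => ⟨isCommutator_zero k, isCommutator_zero k,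
      isTraceClass_zero, fun z => by simp [charFun_zero]⟩⟩
  | add T T' _ _ h h' =>
    obtain ⟨hT, S, W, h⟩ := h
    obtain ⟨hT', S', W', h'⟩ := h'
    refine ⟨hT.add hT', S + S', W + W', fun k => ⟨(h k).1.add (h' k).1, (h k).2.1.add (h' k).2.1,
      (h k).2.2.1.add (h' k).2.2.1, fun z => ?_⟩⟩
    rw [charFun_add hT hT', Pi.add_apply, charFun_add (h k).2.2.1 (h' k).2.2.1, (h k).2.2.2,
      (h' k).2.2.2, mul_add]
  | smul c T _ h =>
    obtain ⟨hT, S, W, h⟩ := h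
    refine ⟨hT.smul c, c • S, c • W, fun k => ⟨(h k).1.smul c, (h k).2.1.smul c,
      (h k).2.2.1.smul c, fun z => ?_⟩⟩
    rw [charFun_smul, Pi.smul_apply, charFun_smul, (h k).2.2.2]
    ring

lemma InitialGenerator.charFun_eq {T U : Op n} (h : InitialGenerator T U) :
    IsTraceClass T ∧ IsTraceClass U ∧
      ∀ z, charFun U z = -(1 / 4) * (‖z‖ ^ 2 : ℝ) * charFun T z := by
  obtain ⟨hT, S, W, hSW, rfl⟩ := h
  obtain ⟨hT1, S', W', h'⟩ := exists_commutators_of_mem_initialDomain hT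
  have hS : ∀ k, S k = S' k := fun k => (hSW k).1.unique (h' k).1
  have hW : W = W' := funext fun k => (hSW k).2.unique (by rw [hS k]; exact (h' k).2.1)
  subst hW
  have hWt : IsTraceClass (∑ k, W k) := isTraceClass_sum _ _ fun k _ => (h' k).2.2.1
  refine ⟨hT1, hWt.smul _, fun z => ?_⟩
  rw [charFun_smul, charFun_sum _ fun k _ => (h' k).2.2.1,
    Finset.sum_congr rfl fun k _ => (h' k).2.2.2 z, ← Finset.sum_mul,
    EuclideanSpace.real_norm_sq_eq]
  push_cast
  ring

/-- At a fixed `z`, evaluation of the characteristic function is a contraction for the trace norm;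
so identities for characteristic functions pass to the closure of the generator. -/
lemma tendsto_charFun {A : Op n} {T : ℕ → Op n} (hA : IsTraceClass A)
    (hT : ∀ m, IsTraceClass (T m)) (h : Tendsto (fun m => traceNorm (T m - A)) atTop (𝓝 0))
    (z : Phase n) : Tendsto (fun m => charFun (T m) z) atTop (𝓝 (charFun A z)) := by
  rw [tendsto_iff_edist_tendsto_0]
  refine tendsto_of_tendsto_of_tendsto_of_le_of_le tendsto_const_nhds h (fun _ => zero_le)
    fun m => ?_
  rw [edist_eq_enorm_sub, ← charFun_sub (hT m) hA]
  exact enorm_charFun_le _ z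

/-- The generator multiplies the characteristic function by `-|z|²/4`. -/
lemma GeneratorGraph.charFun_eq {ρ σ : Op n} (h : GeneratorGraph ρ σ) (z : Phase n) :
    charFun σ z = -(1 / 4) * (‖z‖ ^ 2 : ℝ) * charFun ρ z := by
  obtain ⟨hρ, hσ, T, U, hTU, hT, hU⟩ := h
  have h1 := tendsto_charFun hρ (fun m => (hTU m).charFun_eq.1) hT z
  have h2 := tendsto_charFun hσ (fun m => (hTU m).charFun_eq.2.1) hU z
  refine tendsto_nhds_unique h2 ?_
  simp_rw [(hTU _).charFun_eq.2.2 z]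
  exact h1.const_mul _

end QuantumDiffusion

/-! ### Fourier–Plancherel and square integrability of the Weyl representation -/

namespace QuantumDiffusion

open scoped FourierTransform

section Plancherel

lemma eLpNorm_two_sq {α : Type*} [MeasurableSpace α] {μ : Measure α} (f : α → ℂ) :
    eLpNorm f 2 μ ^ 2 = ∫⁻ x, ‖f x‖ₑ ^ 2 ∂μ := by
  have h := eLpNorm_nnreal_pow_eq_lintegral (μ := μ) (f := f) (p := 2) two_ne_zero
  simpa using h

variable {V : Type*} [NormedAddCommGroup V] [InnerProductSpace ℝ V] [FiniteDimensional ℝ V]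
  [MeasurableSpace V] [BorelSpace V]

/-- On `L¹ ∩ L²` the Fourier transform in `L²` is given by the Fourier integral. -/
lemma coeFn_fourier_toLp_ae {g : V → ℂ} (h1 : Integrable g) (h2 : MemLp g 2) :
    (𝓕 (h2.toLp g) : Lp ℂ 2 (volume : Measure V)) =ᵐ[volume] 𝓕 g := by
  have hcont : Continuous (𝓕 g : V → ℂ) :=
    VectorFourier.fourierIntegral_continuous Real.continuous_fourierChar
      (by exact continuous_inner) h1
  -- Both sides are tested against smooth compactly supported functions; each version of the Fourier
  -- transform can be moved onto the test function.
  refine ae_eq_of_integral_contDiff_smul_eq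
    ((Lp.memLp (𝓕 (h2.toLp g))).locallyIntegrable one_le_two) hcont.locallyIntegrable ?_
  intro s hs hsc
  have hg₁ : HasCompactSupport (Complex.ofRealCLM ∘ s) := hsc.comp_left rfl
  have hg₂ : ContDiff ℝ ((⊤ : ℕ∞) : WithTop ℕ∞) (Complex.ofRealCLM ∘ s) :=
    Complex.ofRealCLM.contDiff.comp hs
  set S : SchwartzMap V ℂ := hg₁.toSchwartzMap hg₂ with hS
  have e1 : ∫ x, s x • (𝓕 (h2.toLp g) : Lp ℂ 2 (volume : Measure V)) x =
      ∫ x, S x • (𝓕 (h2.toLp g) : Lp ℂ 2 (volume : Measure V)) x :=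
    integral_congr_ae (Eventually.of_forall fun x => by simp [hS])
  have e2 : ∫ x, s x • 𝓕 g x = ∫ x, 𝓕 g x • S x :=
    integral_congr_ae (Eventually.of_forall fun x => by simp [hS, mul_comm])
  have e3 : ∫ x, 𝓕 g x • S x = ∫ x, g x • 𝓕 (S : V → ℂ) x := by
    have := VectorFourier.integral_fourierIntegral_smul_eq_flip (L := innerₗ V)
      Real.continuous_fourierChar continuous_inner h1 (S.integrable (μ := volume))
    rw [flip_innerₗ] at this
    exact this
  have e4 : ∫ x, S x • (𝓕 (h2.toLp g) : Lp ℂ 2 (volume : Measure V)) x =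
      ∫ x, (𝓕 S) x • (h2.toLp g : Lp ℂ 2 (volume : Measure V)) x := by
    have := congrArg (fun D : TemperedDistribution V ℂ => D S)
      (Lp.fourier_toTemperedDistribution_eq (h2.toLp g))
    simp only [TemperedDistribution.fourier_apply, Lp.toTemperedDistribution_apply] at this
    exact this.symm
  rw [e1, e2, e3, e4]
  refine integral_congr_ae ?_
  filter_upwards [h2.coeFn_toLp] with x hx
  rw [hx, SchwartzMap.fourier_coe, smul_eq_mul, smul_eq_mul, mul_comm]

/-- Plancherel's theorem on `L¹ ∩ L²`. -/
lemma lintegral_fourier_sq {g : V → ℂ} (h1 : Integrable g) (h2 : MemLp g 2) :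
    ∫⁻ w, ‖𝓕 g w‖ₑ ^ 2 = ∫⁻ x, ‖g x‖ₑ ^ 2 := by
  rw [← eLpNorm_two_sq, ← eLpNorm_two_sq, ← eLpNorm_congr_ae (coeFn_fourier_toLp_ae h1 h2),
    ← Lp.enorm_def, ← ofReal_norm, Lp.norm_fourier_eq, ofReal_norm, Lp.enorm_def,
    eLpNorm_congr_ae h2.coeFn_toLp]

lemma lintegral_comp_smul {f : V → ℝ≥0∞} (hf : Measurable f) {r : ℝ} (hr : r ≠ 0) :
    ∫⁻ x, f (r • x) = ENNReal.ofReal |(r ^ Module.finrank ℝ V)⁻¹| * ∫⁻ x, f x := by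
  rw [← lintegral_map hf (measurable_const_smul r), Measure.map_addHaar_smul _ hr,
    lintegral_smul_measure, smul_eq_mul]

end Plancherel

variable {n : ℕ}

/-- The phase space point with given position and momentum. -/
def phasePoint (q p : Config n) : Phase n := WithLp.toLp 2 (Sum.elim q p)

@[simp] lemma qPart_phasePoint (q p : Config n) : qPart (phasePoint q p) = q := rfl
@[simp] lemma pPart_phasePoint (q p : Config n) : pPart (phasePoint q p) = p := rfl

lemma phasePoint_parts (z : Phase n) : phasePoint (qPart z) (pPart z) = z := by
  ext i; cases i <;> rfl

lemma continuous_phasePoint : Continuous fun y : Config n × Config n => phasePoint y.1 y.2 := by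
  unfold phasePoint
  refine (PiLp.continuous_toLp 2 _).comp (continuous_pi fun i => ?_)
  cases i <;> simp only [Sum.elim_inl, Sum.elim_inr] <;> fun_prop

lemma measurePreserving_parts :
    MeasurePreserving (fun z : Phase n => (qPart z, pPart z)) volume
      ((volume : Measure (Config n)).prod volume) := by
  have h1 := (PiLp.sumPiLpEquivProdLpPiLp (𝕜 := ℝ) 2
    (fun _ : Fin n ⊕ Fin n => ℝ)).measurePreserving
  have h2 := WithLp.volume_preserving_ofLp (Config n) (Config n)
  exact h2.comp h1

lemma lintegral_phase {f : Phase n → ℝ≥0∞} (hf : Measurable f) :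
    ∫⁻ z, f z = ∫⁻ q : Config n, ∫⁻ p : Config n, f (phasePoint q p) := by
  have h := measurePreserving_parts.lintegral_comp
    (hf.comp (continuous_phasePoint (n := n)).measurable)
  simp only [Function.comp_def, phasePoint_parts] at h
  rw [h]
  exact lintegral_prod _ (hf.comp (continuous_phasePoint (n := n)).measurable).aemeasurable

/-- For fixed `q` the matrix coefficient is, up to a phase, a Fourier transform in `p`. The kernel
of `𝓕` is `exp (-2πi⟨x, w⟩)`, hence the frequency `p / 2π`, and after rescaling the factor `(2π)ⁿ`.
-/
lemma inner_weyl_phasePoint (φ ψ : Hilb n) (q p : Config n) :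
    ‖⟪ψ, weyl (phasePoint q p) φ⟫_ℂ‖ₑ =
      ‖𝓕 (fun x => (starRingEnd ℂ) (ψ x) * φ (x + q)) ((2 * Real.pi)⁻¹ • p)‖ₑ := by
  have h : ⟪ψ, weyl (phasePoint q p) φ⟫_ℂ =
      Complex.exp (((-(⟪p, q⟫_ℝ / 2) : ℝ) : ℂ) * Complex.I) *
        𝓕 (fun x => (starRingEnd ℂ) (ψ x) * φ (x + q)) ((2 * Real.pi)⁻¹ • p) := by
    rw [L2.inner_def, Real.fourier_eq', ← integral_const_mul]
    refine integral_congr_ae ?_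
    filter_upwards [weyl_apply_ae (phasePoint q p) φ] with x hx
    rw [hx, RCLike.inner_apply, qPart_phasePoint, smul_eq_mul, ← mul_assoc, ← Complex.exp_add,
      weylPhase, qPart_phasePoint, pPart_phasePoint, inner_smul_right]
    have hpi : (-2 * Real.pi * ((2 * Real.pi)⁻¹ * ⟪x, p⟫_ℝ)) = -⟪p, x⟫_ℝ := by
      rw [real_inner_comm]; field_simp
    rw [hpi]
    have : -Complex.I * ((⟪p, x⟫_ℝ + ⟪p, q⟫_ℝ / 2 : ℝ) : ℂ) =
        ((-(⟪p, q⟫_ℝ / 2) : ℝ) : ℂ) * Complex.I + ((-⟪p, x⟫_ℝ : ℝ) : ℂ) * Complex.I := by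
      push_cast; ring
    rw [this]
    ring
  rw [h, enorm_mul, ← ofReal_norm, Complex.norm_exp_ofReal_mul_I, ENNReal.ofReal_one, one_mul]

lemma enorm_sq_eq_lintegral (φ : Hilb n) : ‖φ‖ₑ ^ 2 = ∫⁻ x, ‖φ x‖ₑ ^ 2 := by
  rw [Lp.enorm_def, eLpNorm_two_sq]

/-- Square integrability of the Weyl representation. -/
lemma lintegral_inner_weyl_sq (φ ψ : Hilb n) :
    ∫⁻ z : Phase n, ‖⟪ψ, weyl z φ⟫_ℂ‖ₑ ^ 2 =
      ENNReal.ofReal ((2 * Real.pi) ^ n) * (‖ψ‖ₑ ^ 2 * ‖φ‖ₑ ^ 2) := by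
  have hmφ := (Lp.stronglyMeasurable φ).measurable
  have hmψ := (Lp.stronglyMeasurable ψ).measurable
  have hmeas : Measurable fun z : Phase n => ‖⟪ψ, weyl z φ⟫_ℂ‖ₑ ^ 2 :=
    ((continuous_const.inner (continuous_weyl_apply φ)).enorm.measurable.pow_const 2)
  rw [lintegral_phase hmeas]
  have hprod : Measurable (Function.uncurry fun (q x : Config n) =>
      ‖ψ x‖ₑ ^ 2 * ‖φ (x + q)‖ₑ ^ 2) := by
    simp only [Function.uncurry_def]
    have : Measurable fun y : Config n × Config n => φ (y.2 + y.1) :=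
      hmφ.comp (measurable_snd.add measurable_fst)
    exact ((hmψ.comp measurable_snd).enorm.pow_const 2).mul (this.enorm.pow_const 2)
  have hfub : ∫⁻ q : Config n, ∫⁻ x : Config n, ‖ψ x‖ₑ ^ 2 * ‖φ (x + q)‖ₑ ^ 2 =
      ‖ψ‖ₑ ^ 2 * ‖φ‖ₑ ^ 2 := by
    rw [lintegral_lintegral_swap hprod.aemeasurable]
    have : ∀ x : Config n, ∫⁻ q : Config n, ‖ψ x‖ₑ ^ 2 * ‖φ (x + q)‖ₑ ^ 2 =
        ‖ψ x‖ₑ ^ 2 * ‖φ‖ₑ ^ 2 := fun x => by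
      have hm : Measurable fun q : Config n => ‖φ (x + q)‖ₑ ^ 2 :=
        (hmφ.comp (measurable_const_add x)).enorm.pow_const 2
      rw [lintegral_const_mul _ hm, lintegral_add_left_eq_self (fun y => ‖φ y‖ₑ ^ 2), enorm_sq_eq_lintegral]
    simp_rw [this]
    rw [lintegral_mul_const _ (hmψ.enorm.pow_const 2), enorm_sq_eq_lintegral ψ]
  -- A product of two `L²` functions need not be in `L²`; Tonelli guarantees it for almost every
  -- translation `q`, which suffices.
  have hfin : ∀ᵐ q : Config n, ∫⁻ x : Config n, ‖ψ x‖ₑ ^ 2 * ‖φ (x + q)‖ₑ ^ 2 < ∞ := by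
    refine ae_lt_top hprod.lintegral_prod_right' ?_
    change ∫⁻ q : Config n, ∫⁻ x : Config n, ‖ψ x‖ₑ ^ 2 * ‖φ (x + q)‖ₑ ^ 2 ≠ ∞
    rw [hfub]
    finiteness
  have hmq : Measurable fun q : Config n => ∫⁻ x : Config n, ‖ψ x‖ₑ ^ 2 * ‖φ (x + q)‖ₑ ^ 2 :=
    hprod.lintegral_prod_right'
  rw [← hfub, ← lintegral_const_mul _ hmq]
  refine lintegral_congr_ae ?_
  filter_upwards [hfin] with q hq
  set g : Config n → ℂ := fun x => (starRingEnd ℂ) (ψ x) * φ (x + q) with hg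
  have hgm : Measurable g :=
    (RCLike.continuous_conj.measurable.comp hmψ).mul (hmφ.comp (measurable_add_const q))
  have hgn : ∀ x, ‖g x‖ₑ ^ 2 = ‖ψ x‖ₑ ^ 2 * ‖φ (x + q)‖ₑ ^ 2 := fun x => by
    simp [hg, mul_pow]
  have h1 : Integrable g := by
    refine MemLp.integrable_mul (p := 2) (q := 2) ?_ ?_
    · exact MemLp.of_le (Lp.memLp ψ)
        (RCLike.continuous_conj.measurable.comp hmψ).aestronglyMeasurable (by simp)
    · exact (Lp.memLp φ).comp_measurePreserving (measurePreserving_add_right volume q)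
  have h2 : MemLp g 2 := by
    refine ⟨hgm.aestronglyMeasurable, ?_⟩
    have : eLpNorm g 2 volume ^ 2 < ∞ := by
      rw [eLpNorm_two_sq]
      simpa only [hgn] using hq
    rw [ENNReal.pow_lt_top_iff] at this
    simpa using this
  have hF : Measurable fun w : Config n => ‖𝓕 g w‖ₑ ^ 2 := by
    have hcont : Continuous (𝓕 g : Config n → ℂ) :=
      VectorFourier.fourierIntegral_continuous Real.continuous_fourierChar
        (by exact continuous_inner) h1
    exact hcont.enorm.measurable.pow_const 2
  simp_rw [inner_weyl_phasePoint]
  rw [lintegral_comp_smul hF (by positivity), lintegral_fourier_sq h1 h2]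
  simp_rw [hgn]
  congr 2
  rw [finrank_euclideanSpace_fin, inv_pow, inv_inv, abs_of_nonneg (by positivity)]

end QuantumDiffusion

/-! ### Moyal's relation and Plancherel's theorem for operators -/

namespace QuantumDiffusion

lemma inner_map_of_norm_sq {E F : Type*} [NormedAddCommGroup E] [InnerProductSpace ℂ E]
    [NormedAddCommGroup F] [InnerProductSpace ℂ F] (S : E →ₗ[ℂ] F) (c : ℝ)
    (h : ∀ x, ‖S x‖ ^ 2 = c * ‖x‖ ^ 2) (x y : E) : ⟪S x, S y⟫_ℂ = c * ⟪x, y⟫_ℂ := by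
  have h' : ∀ x, (‖S x‖ : ℂ) ^ 2 = c * (‖x‖ : ℂ) ^ 2 := fun x => by exact_mod_cast h x
  have e1 := inner_eq_sum_norm_sq_div_four (𝕜 := ℂ) (S x) (S y)
  have e2 := inner_eq_sum_norm_sq_div_four (𝕜 := ℂ) x y
  rw [← map_smul, ← map_add, ← map_sub, ← map_add, ← map_sub] at e1
  simp only [Complex.coe_algebraMap] at e1 e2
  rw [h', h', h', h'] at e1
  rw [e1, e2]
  ring

variable {n : ℕ}

lemma memLp_inner_weyl (ψ φ : Hilb n) :
    MemLp (fun z : Phase n => ⟪ψ, weyl z φ⟫_ℂ) 2 (volume : Measure (Phase n)) := by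
  refine ⟨(continuous_const.inner (continuous_weyl_apply φ)).aestronglyMeasurable, ?_⟩
  have : eLpNorm (fun z : Phase n => ⟪ψ, weyl z φ⟫_ℂ) 2 volume ^ 2 < ∞ := by
    rw [eLpNorm_two_sq, lintegral_inner_weyl_sq]
    finiteness
  rw [ENNReal.pow_lt_top_iff] at this
  simpa using this

/-- The matrix coefficient `z ↦ ⟨ψ, V(z) φ⟩` as an element of `L²`, linear in `φ`. -/
def matrixCoeff (ψ : Hilb n) : Hilb n →ₗ[ℂ] Lp ℂ 2 (volume : Measure (Phase n)) where
  toFun φ := (memLp_inner_weyl ψ φ).toLp _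
  map_add' φ φ' := by
    rw [← MemLp.toLp_add]
    exact MemLp.toLp_congr _ _ (Eventually.of_forall fun z => by simp [inner_add_right])
  map_smul' c φ := by
    rw [RingHom.id_apply, ← MemLp.toLp_const_smul]
    exact MemLp.toLp_congr _ _ (Eventually.of_forall fun z => by simp [inner_smul_right])

lemma matrixCoeff_ae (ψ φ : Hilb n) :
    (matrixCoeff ψ φ : Phase n → ℂ) =ᵐ[volume] fun z => ⟪ψ, weyl z φ⟫_ℂ :=
  (memLp_inner_weyl ψ φ).coeFn_toLp

lemma matrixCoeff_add_left (ψ ψ' φ : Hilb n) :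
    matrixCoeff (ψ + ψ') φ = matrixCoeff ψ φ + matrixCoeff ψ' φ := by
  apply Lp.ext
  filter_upwards [matrixCoeff_ae (ψ + ψ') φ, matrixCoeff_ae ψ φ, matrixCoeff_ae ψ' φ,
    Lp.coeFn_add (matrixCoeff ψ φ) (matrixCoeff ψ' φ)] with z h1 h2 h3 h4
  rw [h1, h4, Pi.add_apply, h2, h3, inner_add_left]

lemma matrixCoeff_smul_left (c : ℂ) (ψ φ : Hilb n) :
    matrixCoeff (c • ψ) φ = (starRingEnd ℂ) c • matrixCoeff ψ φ := by
  apply Lp.ext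
  filter_upwards [matrixCoeff_ae (c • ψ) φ, matrixCoeff_ae ψ φ,
    Lp.coeFn_smul ((starRingEnd ℂ) c) (matrixCoeff ψ φ)] with z h1 h2 h3
  rw [h1, h3, Pi.smul_apply, h2, inner_smul_left, smul_eq_mul]

lemma norm_matrixCoeff_sq (ψ φ : Hilb n) :
    ‖matrixCoeff ψ φ‖ ^ 2 = (2 * Real.pi) ^ n * ‖ψ‖ ^ 2 * ‖φ‖ ^ 2 := by
  have h : ‖matrixCoeff ψ φ‖ₑ ^ 2 = ENNReal.ofReal ((2 * Real.pi) ^ n * ‖ψ‖ ^ 2 * ‖φ‖ ^ 2) := by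
    rw [Lp.enorm_def, eLpNorm_congr_ae (matrixCoeff_ae ψ φ), eLpNorm_two_sq,
      lintegral_inner_weyl_sq, ENNReal.ofReal_mul (by positivity),
      ENNReal.ofReal_mul (by positivity), ENNReal.ofReal_pow (norm_nonneg _),
      ENNReal.ofReal_pow (norm_nonneg _), ofReal_norm, ofReal_norm, mul_assoc]
  rw [← ofReal_norm, ← ENNReal.ofReal_pow (norm_nonneg _),
    ENNReal.ofReal_eq_ofReal_iff (by positivity) (by positivity)] at h
  exact h

lemma norm_matrixCoeff (ψ φ : Hilb n) :
    ‖matrixCoeff ψ φ‖ = Real.sqrt ((2 * Real.pi) ^ n) * (‖ψ‖ * ‖φ‖) := by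
  rw [← sq_eq_sq₀ (norm_nonneg _) (by positivity), norm_matrixCoeff_sq, mul_pow (Real.sqrt _),
    Real.sq_sqrt (by positivity), mul_pow ‖ψ‖, mul_assoc]

lemma inner_matrixCoeff_same (ψ φ φ' : Hilb n) :
    ⟪matrixCoeff ψ φ, matrixCoeff ψ φ'⟫_ℂ = (2 * Real.pi : ℂ) ^ n * (⟪φ, φ'⟫_ℂ * ⟪ψ, ψ⟫_ℂ) := by
  rw [inner_map_of_norm_sq (matrixCoeff ψ) ((2 * Real.pi) ^ n * ‖ψ‖ ^ 2)
    (norm_matrixCoeff_sq ψ), inner_self_eq_norm_sq_to_K]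
  push_cast
  simp only [Complex.coe_algebraMap]
  ring

/-- Moyal's orthogonality relation. -/
lemma inner_matrixCoeff (ψ ψ' φ φ' : Hilb n) :
    ⟪matrixCoeff ψ φ, matrixCoeff ψ' φ'⟫_ℂ =
      (2 * Real.pi : ℂ) ^ n * (⟪φ, φ'⟫_ℂ * ⟪ψ', ψ⟫_ℂ) := by
  -- Polarisation in the conjugate-linear slot: the sums with `ψ'` and with `i ψ'` isolate the mixed
  -- term.
  have h1 := inner_matrixCoeff_same (ψ + ψ') φ φ'
  have h2 := inner_matrixCoeff_same (ψ + Complex.I • ψ') φ φ'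
  have h3 := inner_matrixCoeff_same ψ φ φ'
  have h4 := inner_matrixCoeff_same ψ' φ φ'
  simp only [matrixCoeff_add_left, matrixCoeff_smul_left, inner_add_left, inner_add_right,
    inner_smul_left, inner_smul_right, Complex.conj_I, map_neg, neg_neg] at h1 h2
  have hI := Complex.I_mul_I
  set u := ⟪matrixCoeff ψ φ, matrixCoeff ψ' φ'⟫_ℂ
  set v := ⟪matrixCoeff ψ' φ, matrixCoeff ψ φ'⟫_ℂ
  set w := ⟪matrixCoeff ψ' φ, matrixCoeff ψ' φ'⟫_ℂ
  set k := (2 * Real.pi : ℂ) ^ n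
  set s := ⟪φ, φ'⟫_ℂ
  linear_combination (1 / 2 : ℂ) * h1 + (Complex.I / 2) * h2 - (1 / 2 + Complex.I / 2) * h3
    - (1 / 2 + Complex.I / 2) * h4 - (1 / 2) *
      (v - u + (k * s) * (⟪ψ', ψ⟫_ℂ - ⟪ψ, ψ'⟫_ℂ) - Complex.I * (w - k * s * ⟪ψ', ψ'⟫_ℂ)) * hI

/-- Distinct basis vectors are at distance `√2`, so the balls of radius `1/2` around them are
disjoint. Countability is needed to integrate series term by term. -/
instance countable_basisSet {H : Type*} [NormedAddCommGroup H] [InnerProductSpace ℂ H]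
    [CompleteSpace H] [SecondCountableTopology H] : Countable (basisSet H) := by
  have hdisj : Set.PairwiseDisjoint (Set.univ : Set (basisSet H))
      fun i => Metric.ball (onb H i) (1 / 2) := by
    intro i _ j _ hij
    refine Metric.ball_disjoint_ball ?_
    have h : dist (onb H i) (onb H j) ^ 2 = 2 := by
      rw [dist_eq_norm, @norm_sub_sq ℂ, (onb H).orthonormal.1, (onb H).orthonormal.1,
        (onb H).orthonormal.2 hij]
      norm_num
    nlinarith [dist_nonneg (x := onb H i) (y := onb H j)]
  have := hdisj.countable_of_isOpen (fun i _ => Metric.isOpen_ball)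
    (fun i _ => ⟨onb H i, Metric.mem_ball_self (by norm_num)⟩)
  exact Set.countable_univ_iff.1 this

lemma IsExpansion.hasSum_charFun {ι : Type*} {A : Op n} {a b : ι → Hilb n}
    (h : IsExpansion A a b) (hs : ∑' j, ‖a j‖ₑ * ‖b j‖ₑ < ∞) (z : Phase n) :
    HasSum (fun j => ⟪b j, weyl z (a j)⟫_ℂ) (charFun A z) := by
  have h1 := (h.mul_right (weyl z)).hasSum_tr
    ((ENNReal.tsum_le_tsum fun j => ?_).trans_lt hs)
  · simp only [ContinuousLinearMap.adjoint_inner_left] at h1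
    exact h1
  · gcongr
    exact enorm_apply_le_of_norm_le_one
      (by rw [LinearIsometryEquiv.norm_map]; exact norm_weyl_le z) _

lemma summable_norm_of_tsum_enorm {ι E : Type*} [NormedAddCommGroup E] {a b : ι → E}
    (hs : ∑' j, ‖a j‖ₑ * ‖b j‖ₑ < ∞) : Summable fun j => ‖a j‖ * ‖b j‖ := by
  refine summable_of_tsum_enorm_lt_top (lt_of_eq_of_lt (tsum_congr fun j => ?_) hs)
  rw [enorm_mul, enorm_norm, enorm_norm]

lemma integrable_conj_mul_inner_weyl (ψ φ ψ' φ' : Hilb n) :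
    Integrable fun z : Phase n => (starRingEnd ℂ) ⟪ψ, weyl z φ⟫_ℂ * ⟪ψ', weyl z φ'⟫_ℂ := by
  refine MemLp.integrable_mul (p := 2) (q := 2) ?_ (memLp_inner_weyl ψ' φ')
  exact (memLp_inner_weyl ψ φ).star

lemma integral_conj_mul_inner_weyl (ψ φ ψ' φ' : Hilb n) :
    ∫ z : Phase n, (starRingEnd ℂ) ⟪ψ, weyl z φ⟫_ℂ * ⟪ψ', weyl z φ'⟫_ℂ =
      (2 * Real.pi : ℂ) ^ n * (⟪φ, φ'⟫_ℂ * ⟪ψ', ψ⟫_ℂ) := by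
  rw [← inner_matrixCoeff, L2.inner_def]
  refine integral_congr_ae ?_
  filter_upwards [matrixCoeff_ae ψ φ, matrixCoeff_ae ψ' φ'] with z h1 h2
  rw [h1, h2, RCLike.inner_apply, mul_comm]

/-- Cauchy–Schwarz in `L²` for the moduli, whose norms Moyal's relation gives exactly. This is the
`L¹` bound that justifies termwise integration. -/
lemma integral_norm_conj_mul_inner_weyl_le (ψ φ ψ' φ' : Hilb n) :
    ∫ z : Phase n, ‖(starRingEnd ℂ) ⟪ψ, weyl z φ⟫_ℂ * ⟪ψ', weyl z φ'⟫_ℂ‖ ≤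
      (2 * Real.pi) ^ n * ((‖φ‖ * ‖ψ‖) * (‖φ'‖ * ‖ψ'‖)) := by
  have h1 : ‖(memLp_inner_weyl ψ φ).norm.toLp _‖ = ‖matrixCoeff ψ φ‖ := by
    rw [Lp.norm_toLp, eLpNorm_norm]; exact (Lp.norm_toLp _ (memLp_inner_weyl ψ φ)).symm
  have h2 : ‖(memLp_inner_weyl ψ' φ').norm.toLp _‖ = ‖matrixCoeff ψ' φ'‖ := by
    rw [Lp.norm_toLp, eLpNorm_norm]; exact (Lp.norm_toLp _ (memLp_inner_weyl ψ' φ')).symm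
  have h3 : ∫ z : Phase n, ‖(starRingEnd ℂ) ⟪ψ, weyl z φ⟫_ℂ * ⟪ψ', weyl z φ'⟫_ℂ‖ =
      ⟪(memLp_inner_weyl ψ φ).norm.toLp _, (memLp_inner_weyl ψ' φ').norm.toLp _⟫_ℝ := by
    rw [L2.inner_def]
    refine integral_congr_ae ?_
    filter_upwards [(memLp_inner_weyl ψ φ).norm.coeFn_toLp,
      (memLp_inner_weyl ψ' φ').norm.coeFn_toLp] with z h4 h5
    rw [h4, h5, norm_mul, RCLike.norm_conj, RCLike.inner_apply, mul_comm]
    rfl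
  rw [h3]
  refine (real_inner_le_norm _ _).trans_eq ?_
  rw [h1, h2, norm_matrixCoeff, norm_matrixCoeff]
  have := Real.mul_self_sqrt (show 0 ≤ (2 * Real.pi) ^ n by positivity)
  linear_combination (‖ψ‖ * ‖φ‖ * ‖ψ'‖ * ‖φ'‖) * this

/-- Plancherel's theorem for characteristic functions of trace class operators. -/
lemma integral_conj_charFun_mul_charFun {A B : Op n} (hA : IsTraceClass A)
    (hB : IsTraceClass B) :
    ∫ z : Phase n, (starRingEnd ℂ) (charFun A z) * charFun B z =
      (2 * Real.pi : ℂ) ^ n * tr (ContinuousLinearMap.adjoint A * B) := by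
  obtain ⟨a, b, hab, hs⟩ := exists_isExpansion A
  obtain ⟨c, d, hcd, hs'⟩ := exists_isExpansion B
  have hs := hs.trans_lt hA
  have hs' := hs'.trans_lt hB
  have hsum := (summable_norm_of_tsum_enorm hs).mul_of_nonneg (summable_norm_of_tsum_enorm hs')
    (fun j => by positivity) (fun j => by positivity)
  have hfact : Fact ((2 : ℝ≥0∞) ≠ ∞) := ⟨ENNReal.ofNat_ne_top⟩
  have hsc : SecondCountableTopology (Hilb n) := inferInstance
  have hcount : Countable (basisSet (Hilb n)) := inferInstance
  set F : basisSet (Hilb n) × basisSet (Hilb n) → Phase n → ℂ := fun p z =>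
    (starRingEnd ℂ) ⟪b p.1, weyl z (a p.1)⟫_ℂ * ⟪d p.2, weyl z (c p.2)⟫_ℂ with hF
  have hint := hasSum_integral_of_summable_integral_norm (F := F) (μ := volume)
    (fun p => integrable_conj_mul_inner_weyl _ _ _ _)
    (Summable.of_nonneg_of_le (fun p => integral_nonneg fun _ => norm_nonneg _)
      (fun p => integral_norm_conj_mul_inner_weyl_le _ _ _ _) (hsum.mul_left _))
  have hnorm : ∀ (x y : Hilb n) (z : Phase n), ‖⟪x, weyl z y⟫_ℂ‖ ≤ ‖y‖ * ‖x‖ := fun x y z => by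
    rw [mul_comm, ← norm_weyl_apply z y]
    exact norm_inner_le_norm _ _
  have hpt : ∀ z, ∑' p, F p z = (starRingEnd ℂ) (charFun A z) * charFun B z := fun z => by
    have h1 := (hab.hasSum_charFun hs z).map (starRingEnd ℂ) RCLike.continuous_conj
    have h2 := hcd.hasSum_charFun hs' z
    have h3 : Summable fun p : basisSet (Hilb n) × basisSet (Hilb n) => F p z :=
      Summable.of_norm_bounded hsum fun p => by
        rw [hF]
        simp only [norm_mul, RCLike.norm_conj]
        exact mul_le_mul (hnorm _ _ _) (hnorm _ _ _) (norm_nonneg _) (by positivity)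
    exact (h1.mul h2 h3).tsum_eq
  simp_rw [hpt] at hint
  simp only [hF, integral_conj_mul_inner_weyl] at hint
  -- The two indices are exchanged so that the expansion of `A` is summed first: it resums to `⟪d k,
  -- A* (c k)⟫`, and the remaining sum is the trace of `A* B` computed from the expansion `(A* (c
  -- k), d k)`.
  have hint' : HasSum (fun p : basisSet (Hilb n) × basisSet (Hilb n) =>
      (2 * Real.pi : ℂ) ^ n * (⟪d p.1, b p.2⟫_ℂ * ⟪a p.2, c p.1⟫_ℂ))
      (∫ z : Phase n, (starRingEnd ℂ) (charFun A z) * charFun B z) := by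
    rw [← (Equiv.prodComm _ _).hasSum_iff]
    refine hint.congr_fun fun p => ?_
    simp only [Function.comp_apply, Equiv.prodComm_apply, Prod.fst_swap, Prod.snd_swap]
    rw [mul_comm ⟪d p.2, b p.1⟫_ℂ]
  have hfib : ∀ k, HasSum (fun j => (2 * Real.pi : ℂ) ^ n * (⟪d k, b j⟫_ℂ * ⟪a j, c k⟫_ℂ))
      ((2 * Real.pi : ℂ) ^ n * ⟪d k, ContinuousLinearMap.adjoint A (c k)⟫_ℂ) := fun k => by
    refine HasSum.mul_left _ ?_
    rw [ContinuousLinearMap.adjoint_inner_right]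
    have h1 := ((hab (d k)).mapL (innerSL ℂ (c k))).map (starRingEnd ℂ) RCLike.continuous_conj
    simpa [Function.comp_def, inner_smul_right, inner_conj_symm] using h1
  have h4 := hint'.prod_fiberwise hfib
  have hWs : ∑' k, ‖ContinuousLinearMap.adjoint A (c k)‖ₑ * ‖d k‖ₑ < ∞ := by
    refine (ENNReal.tsum_le_tsum (g := fun k => ‖ContinuousLinearMap.adjoint A‖ₑ *
      (‖c k‖ₑ * ‖d k‖ₑ)) fun k => ?_).trans_lt ?_
    · rw [← mul_assoc]
      gcongr
      exact ContinuousLinearMap.le_opENorm _ _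
    · rw [ENNReal.tsum_mul_left]
      exact ENNReal.mul_lt_top enorm_lt_top hs'
  have h5 := ((hcd.mul_left (ContinuousLinearMap.adjoint A)).hasSum_tr hWs).mul_left
    ((2 * Real.pi : ℂ) ^ n)
  exact h4.unique h5

end QuantumDiffusion

/-! ### The Nash inequality for states in the domain of the generator -/

namespace QuantumDiffusion

section States

variable {H : Type*} [NormedAddCommGroup H] [InnerProductSpace ℂ H] [CompleteSpace H]
  {ρ : H →L[ℂ] H}

lemma IsState.nonneg (h : IsState ρ) : 0 ≤ ρ :=
  ContinuousLinearMap.nonneg_iff_isPositive ρ |>.2 h.isPositive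

lemma IsState.adjoint_eq (h : IsState ρ) : ContinuousLinearMap.adjoint ρ = ρ :=
  h.isPositive.isSelfAdjoint.adjoint_eq

lemma IsState.posTrace_eq_one (h : IsState ρ) : posTrace ρ = 1 := by
  have h1 := Complex.hasSum_re h.isTraceClass.summable.hasSum
  have h2 : tr ρ = 1 := h.tr_eq_one
  rw [tr] at h2
  rw [h2, Complex.one_re] at h1
  rw [posTrace, ← ENNReal.ofReal_tsum_of_nonneg _ h1.summable, h1.tsum_eq, ENNReal.ofReal_one]
  exact fun i => (h.isPositive.inner_nonneg_right (onb H i)).1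

lemma IsState.traceNorm_eq_one (h : IsState ρ) : traceNorm ρ = 1 := by
  rw [traceNorm, CFC.abs_of_nonneg ρ h.nonneg, h.posTrace_eq_one]

lemma IsTraceClass.mul_left {A : H →L[ℂ] H} (hA : IsTraceClass A) (W : H →L[ℂ] H) :
    IsTraceClass (W * A) := by
  obtain ⟨a, b, h, hs⟩ := exists_isExpansion A
  refine (h.mul_left W).traceNorm_le.trans_lt ((ENNReal.tsum_le_tsum
    (g := fun k => ‖W‖ₑ * (‖a k‖ₑ * ‖b k‖ₑ)) fun k => ?_).trans_lt ?_)
  · rw [← mul_assoc]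
    gcongr
    exact ContinuousLinearMap.le_opENorm _ _
  · rw [ENNReal.tsum_mul_left]
    exact ENNReal.mul_lt_top enorm_lt_top (hs.trans_lt hA)

lemma posTrace_abs_sq_eq_tr {A : H →L[ℂ] H} (hA : IsTraceClass A) :
    posTrace (CFC.abs A ^ 2) = ENNReal.ofReal (tr (ContinuousLinearMap.adjoint A * A)).re := by
  have h1 := Complex.hasSum_re (hA.mul_left (ContinuousLinearMap.adjoint A)).summable.hasSum
  rw [tr, ← h1.tsum_eq, ENNReal.ofReal_tsum_of_nonneg _ h1.summable]
  · rw [posTrace, CFC.abs_sq, ContinuousLinearMap.star_eq_adjoint]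
  · intro i
    rw [mul_apply_eq_comp, ContinuousLinearMap.adjoint_inner_right]
    exact inner_self_nonneg (𝕜 := ℂ)

end States

variable {n : ℕ}

lemma IsState.norm_charFun_le {ρ : Op n} (h : IsState ρ) (z : Phase n) : ‖charFun ρ z‖ ≤ 1 := by
  have h1 := (enorm_charFun_le ρ z).trans_eq h.traceNorm_eq_one
  rw [← ofReal_norm] at h1
  exact ENNReal.ofReal_le_one.1 h1

section Nash

variable {V : Type*} [NormedAddCommGroup V] [InnerProductSpace ℝ V] [FiniteDimensional ℝ V]
  [MeasurableSpace V] [BorelSpace V]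

lemma integrable_norm_sq_of_schwartz (f : SchwartzMap V ℂ) (h : ∀ z, ‖f z‖ ≤ 1) (k : ℕ) :
    Integrable fun z => ‖z‖ ^ k * ‖f z‖ ^ 2 := by
  refine (f.integrable_pow_mul volume k).mono' (by fun_prop) (Eventually.of_forall fun z => ?_)
  rw [Real.norm_of_nonneg (by positivity)]
  gcongr
  nlinarith [norm_nonneg (f z), h z]

/-- Splitting the integral of `|f|²` at radius `R`. -/
lemma integral_norm_sq_le (f : SchwartzMap V ℂ) (h : ∀ z, ‖f z‖ ≤ 1) {R : ℝ} (hR : 0 < R) :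
    ∫ z, ‖f z‖ ^ 2 ≤ R ^ Module.finrank ℝ V * volume.real (Metric.ball (0 : V) 1) +
      R⁻¹ ^ 2 * ∫ z, ‖z‖ ^ 2 * ‖f z‖ ^ 2 := by
  have hball : volume.real (Metric.ball (0 : V) R) =
      R ^ Module.finrank ℝ V * volume.real (Metric.ball (0 : V) 1) := by
    rw [Measure.real, Measure.addHaar_ball_of_pos _ _ hR, ENNReal.toReal_mul,
      ENNReal.toReal_ofReal (by positivity), Measure.real]
  have hi1 : Integrable (Set.indicator (Metric.ball (0 : V) R) fun _ => (1 : ℝ)) :=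
    (integrable_indicator_iff measurableSet_ball).2
      (integrableOn_const (measure_ball_lt_top).ne)
  have hi2 := (integrable_norm_sq_of_schwartz f h 2).const_mul (R⁻¹ ^ 2)
  rw [← hball, ← integral_const_mul]
  have h1 : volume.real (Metric.ball (0 : V) R) =
      ∫ z, Set.indicator (Metric.ball (0 : V) R) (fun _ => (1 : ℝ)) z := by
    rw [integral_indicator measurableSet_ball]
    simp
  rw [h1, ← integral_add hi1 hi2]
  refine integral_mono (by simpa using integrable_norm_sq_of_schwartz f h 0) (hi1.add hi2)
    fun z => ?_
  simp only
  by_cases hz : z ∈ Metric.ball (0 : V) R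
  · rw [Set.indicator_of_mem hz]
    have : 0 ≤ R⁻¹ ^ 2 * (‖z‖ ^ 2 * ‖f z‖ ^ 2) := by positivity
    nlinarith [norm_nonneg (f z), h z]
  · rw [Set.indicator_of_notMem hz, zero_add, ← mul_assoc]
    refine le_mul_of_one_le_left (by positivity) ?_
    rw [← mul_pow]
    have : R ≤ ‖z‖ := by simpa using hz
    have h3 : 1 ≤ R⁻¹ * ‖z‖ := by
      rw [inv_mul_eq_div, one_le_div hR]; exact this
    exact one_le_pow₀ h3

end Nash

lemma rpow_le_of_forall_le {m : ℕ} (hm : 1 ≤ m) {N D w : ℝ} (hN : 0 ≤ N) (hD : 0 ≤ D)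
    (hw : 0 < w) (h : ∀ R : ℝ, 0 < R → N ≤ R ^ (2 * m) * w + R⁻¹ ^ 2 * D) :
    N ^ (1 + 1 / (m : ℝ)) ≤ 2 * (2 * w) ^ (1 / (m : ℝ)) * D := by
  have hm' : (0 : ℝ) < m := by exact_mod_cast hm
  rcases hN.eq_or_lt with rfl | hN
  · rw [Real.zero_rpow (by positivity)]; positivity
  -- With `R² = S` the first term of the bound is exactly `N / 2` and can be absorbed on the left.
  set S : ℝ := (N / (2 * w)) ^ (1 / (m : ℝ)) with hS
  have hSpos : 0 < S := by positivity
  have hSm : S ^ m = N / (2 * w) := by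
    rw [hS, ← Real.rpow_natCast, ← Real.rpow_mul (by positivity), one_div,
      inv_mul_cancel₀ hm'.ne', Real.rpow_one]
  have h1 := h (Real.sqrt S) (Real.sqrt_pos.2 hSpos)
  rw [pow_mul, Real.sq_sqrt hSpos.le, inv_pow, Real.sq_sqrt hSpos.le, hSm] at h1
  have h2 : N / (2 * w) * w = N / 2 := by field_simp
  rw [h2] at h1
  have h3 : N * S ≤ 2 * D := by
    have h4 : N / 2 ≤ S⁻¹ * D := by linarith
    rw [inv_mul_eq_div, le_div_iff₀ hSpos] at h4
    linarith
  have h5 : N ^ (1 + 1 / (m : ℝ)) = N * S * (2 * w) ^ (1 / (m : ℝ)) := by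
    rw [Real.rpow_add hN, Real.rpow_one, hS, Real.div_rpow hN.le (by positivity)]
    field_simp
  rw [h5]
  calc N * S * (2 * w) ^ (1 / (m : ℝ)) ≤ 2 * D * (2 * w) ^ (1 / (m : ℝ)) := by gcongr
    _ = _ := by ring

/-- Plancherel for the pair `ρ`, `ℒ(ρ)`. The choice made in `generator` is harmless: every
admissible value has the characteristic function `-‖z‖² χ_ρ / 4`. -/
lemma dirichletForm_eq {ρ : Op n} (hρ : IsState ρ) (hd : ρ ∈ generatorDomain n) :
    (2 * Real.pi : ℂ) ^ n * dirichletForm ρ =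
      ((1 / 4 * ∫ z : Phase n, ‖z‖ ^ 2 * ‖charFun ρ z‖ ^ 2 : ℝ) : ℂ) := by
  have hg : GeneratorGraph ρ (generator ρ) := by
    have hd' : ∃ σ, GeneratorGraph ρ σ := hd
    rw [generator, dif_pos hd']
    exact hd'.choose_spec
  have h := integral_conj_charFun_mul_charFun hg.1 hg.2.1
  rw [hρ.adjoint_eq] at h
  rw [dirichletForm, mul_neg, ← h, ← integral_neg, ← integral_const_mul, ← integral_complex_ofReal]
  refine integral_congr_ae (Eventually.of_forall fun z => ?_)
  simp only
  rw [hg.charFun_eq]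
  have h2 := Complex.conj_mul' (charFun ρ z)
  push_cast
  linear_combination (1 / 4 * (‖z‖ : ℂ) ^ 2) * h2

lemma hsNorm_rpow_eq {ρ : Op n} (hn : 1 ≤ n) (hρ : IsState ρ) :
    hsNorm ρ ^ (2 + 2 / (n : ℝ)) = ENNReal.ofReal
      ((((2 * Real.pi) ^ n)⁻¹ * ∫ z : Phase n, ‖charFun ρ z‖ ^ 2) ^ (1 + 1 / (n : ℝ))) := by
  have h := integral_conj_charFun_mul_charFun hρ.isTraceClass hρ.isTraceClass
  have h1 : ∫ z : Phase n, (starRingEnd ℂ) (charFun ρ z) * charFun ρ z =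
      ((∫ z : Phase n, ‖charFun ρ z‖ ^ 2 : ℝ) : ℂ) := by
    rw [← integral_complex_ofReal]
    refine integral_congr_ae (Eventually.of_forall fun z => ?_)
    simp only
    rw [Complex.conj_mul']
    push_cast
    rfl
  have hpi : (2 * Real.pi : ℂ) ^ n ≠ 0 := by
    have : (2 * Real.pi : ℂ) ≠ 0 := by exact_mod_cast (by positivity : (2 * Real.pi : ℝ) ≠ 0)
    exact pow_ne_zero _ this
  have h2 : tr (ContinuousLinearMap.adjoint ρ * ρ) =
      (((((2 * Real.pi) ^ n)⁻¹ * ∫ z : Phase n, ‖charFun ρ z‖ ^ 2 : ℝ)) : ℂ) := by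
    push_cast
    rw [← h1, h, inv_mul_cancel_left₀ hpi]
  have hnn : (0 : ℝ) ≤ ((2 * Real.pi) ^ n)⁻¹ * ∫ z : Phase n, ‖charFun ρ z‖ ^ 2 :=
    mul_nonneg (by positivity) (integral_nonneg fun z => by positivity)
  rw [hsNorm, posTrace_abs_sq_eq_tr hρ.isTraceClass, h2, Complex.ofReal_re, ← ENNReal.rpow_mul,
    ENNReal.ofReal_rpow_of_nonneg hnn (by positivity)]
  congr 2
  ring

/-- The Nash inequality for Schwartz states in the domain of the generator. -/
lemma exists_nash_constant (n : ℕ) (hn : 1 ≤ n) :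
    ∃ C : ℝ, 0 < C ∧ ∀ ρ : Op n, IsSchwartzState ρ → ρ ∈ generatorDomain n →
      (dirichletForm ρ).im = 0 ∧
        hsNorm ρ ^ (2 + 2 / (n : ℝ)) ≤ ENNReal.ofReal (C * (dirichletForm ρ).re) := by
  set w : ℝ := volume.real (Metric.ball (0 : Phase n) 1) with hw
  have hwpos : 0 < w := ENNReal.toReal_pos (Metric.measure_ball_pos _ _ one_pos).ne'
    measure_ball_lt_top.ne
  set c : ℝ := (2 * Real.pi) ^ n with hc
  have hcpos : 0 < c := by positivity
  -- The first factor converts `∫ |χ|²` into the Hilbert–Schmidt norm, the second comes from the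
  -- choice of radius, and `4 * c` turns the Dirichlet form into `∫ ‖z‖² |χ|²`.
  refine ⟨c⁻¹ ^ (1 + 1 / (n : ℝ)) * (2 * (2 * w) ^ (1 / (n : ℝ))) * (4 * c), by positivity,
    fun ρ hρ hd => ?_⟩
  obtain ⟨f, hf⟩ := hρ.schwartz
  have hf1 : ∀ z, ‖f z‖ ≤ 1 := fun z => by
    rw [← hf]; exact hρ.isState.norm_charFun_le z
  have hE := dirichletForm_eq hρ.isState hd
  have hcC : ((2 * Real.pi : ℂ)) ^ n = (c : ℂ) := by rw [hc]; push_cast; rfl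
  have hE' : dirichletForm ρ =
      ((c⁻¹ * (1 / 4 * ∫ z : Phase n, ‖z‖ ^ 2 * ‖charFun ρ z‖ ^ 2) : ℝ) : ℂ) := by
    have hc0 : (c : ℂ) ≠ 0 := by exact_mod_cast hcpos.ne'
    rw [Complex.ofReal_mul, ← hE, hcC, Complex.ofReal_inv, inv_mul_cancel_left₀ hc0]
  refine ⟨by rw [hE', Complex.ofReal_im], ?_⟩
  rw [hsNorm_rpow_eq hn hρ.isState, hE', Complex.ofReal_re]
  refine ENNReal.ofReal_le_ofReal ?_
  simp_rw [hf]
  set N : ℝ := ∫ z : Phase n, ‖f z‖ ^ 2 with hN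
  set D : ℝ := ∫ z : Phase n, ‖z‖ ^ 2 * ‖f z‖ ^ 2 with hD
  have hN0 : 0 ≤ N := integral_nonneg fun z => by positivity
  have hD0 : 0 ≤ D := integral_nonneg fun z => by positivity
  have hdim : Module.finrank ℝ (Phase n) = 2 * n := by
    rw [finrank_euclideanSpace, Fintype.card_sum, Fintype.card_fin]; ring
  have key := rpow_le_of_forall_le hn hN0 hD0 hwpos fun R hR => by
    have := integral_norm_sq_le f hf1 hR
    rwa [hdim] at this
  rw [Real.mul_rpow (by positivity) hN0]
  calc c⁻¹ ^ (1 + 1 / (n : ℝ)) * N ^ (1 + 1 / (n : ℝ))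
      ≤ c⁻¹ ^ (1 + 1 / (n : ℝ)) * (2 * (2 * w) ^ (1 / (n : ℝ)) * D) := by gcongr
    _ = _ := by field_simp

end QuantumDiffusion

/-! ### Moments of the vectors in an expansion from smoothness of the characteristic function -/

namespace QuantumDiffusion

section Curve

variable {K : Type*} [NormedAddCommGroup K] [InnerProductSpace ℂ K] [NormedSpace ℝ K]
  [IsScalarTower ℝ ℂ K]

/-- The mixed second difference of `c` is `-k h c''(0)` up to `o(|h| |k|)`, jointly in `h` and `k`:
the mean value inequality in `k`, with the derivative controlled by strict differentiability of `c'`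
at `0`. -/
lemma exists_second_difference_bound {c : ℝ → ℂ} (hc : ContDiff ℝ 2 c) {ε : ℝ} (hε : 0 < ε) :
    ∃ δ > 0, ∀ h k : ℝ, |h| < δ → |k| < δ →
      ‖c (k - h) - c k - c (-h) + c 0 + (k * h : ℝ) * deriv (deriv c) 0‖ ≤ ε * |h| * |k| := by
  have hd1 : ContDiff ℝ 1 (deriv c) := by
    have := (contDiff_succ_iff_deriv (n := 1)).1 (by simpa using! hc)
    exact this.2.2
  have hcd : Differentiable ℝ c := hc.differentiable (by norm_num)
  have hstrict : HasStrictDerivAt (deriv c) (deriv (deriv c) 0) 0 :=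
    hd1.contDiffAt.hasStrictDerivAt one_ne_zero
  have h1 := (HasStrictFDerivAt.isLittleO hstrict).def hε
  rw [nhds_prod_eq, Filter.eventually_prod_iff] at h1
  obtain ⟨p, hp, q, hq, hpq⟩ := h1
  obtain ⟨δ, hδ, hδpq⟩ := Metric.eventually_nhds_iff.1 (hp.and hq)
  refine ⟨δ / 2, half_pos hδ, fun h k hh hk => ?_⟩
  set e := deriv (deriv c) 0 with he
  have hder : ∀ x : ℝ, HasDerivAt (fun x : ℝ => c (x - h) - c x + (x * h : ℝ) * e)
      (deriv c (x - h) - deriv c x + (h : ℂ) * e) x := fun x => by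
    have e1 : HasDerivAt (fun x : ℝ => c (x - h)) (deriv c (x - h)) x :=
      (hcd (x - h)).hasDerivAt.comp_sub_const x h
    have e2 : HasDerivAt (fun x : ℝ => ((x * h : ℝ) : ℂ)) (h : ℂ) x := by
      simpa using ((hasDerivAt_id x).mul_const h).ofReal_comp
    exact (e1.sub (hcd x).hasDerivAt).add (e2.mul_const e)
  have hmv := Convex.norm_image_sub_le_of_norm_hasDerivWithin_le (s := Metric.ball (0 : ℝ) (δ / 2))
    (C := ε * |h|) (x := 0) (y := k) (fun x _ => (hder x).hasDerivWithinAt) ?_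
    (convex_ball _ _) (Metric.mem_ball_self (half_pos hδ)) (by simpa using hk)
  · rw [zero_sub, zero_mul, sub_zero, Real.norm_eq_abs k] at hmv
    have h4 : c (k - h) - c k - c (-h) + c 0 + (k * h : ℝ) * e =
        c (k - h) - c k + (k * h : ℝ) * e - (c (-h) - c 0 + ((0 : ℝ) : ℂ) * e) := by
      rw [Complex.ofReal_zero]
      ring
    rwa [h4]
  · intro x hx
    have hx' : |x| < δ / 2 := by simpa using hx
    have h2 := hpq (hδpq (y := x - h) ?_).1 (hδpq (y := x) ?_).2
    · have h3 : (deriv c (x - h) - deriv c x + (h : ℂ) * e) =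
          deriv c (x - h) - deriv c x - (x - h - x) • e := by
        rw [Complex.real_smul]; push_cast; ring
      rw [h3]
      simpa using h2
    · rw [Real.dist_eq, sub_zero]
      exact (abs_sub _ _).trans_lt (by linarith)
    · rw [Real.dist_eq, sub_zero]
      linarith

/-- A curve with stationary, `C²` correlation function is differentiable. -/
lemma exists_hasDerivAt_of_inner_eq [CompleteSpace K] {u : ℝ → K} {c : ℝ → ℂ}
    (hc : ContDiff ℝ 2 c)
    (h : ∀ s t, ⟪u s, u t⟫_ℂ = c (t - s)) (t : ℝ) : ∃ x, HasDerivAt u x t := by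
  set D : ℝ → K := fun r => r⁻¹ • (u (t + r) - u t) with hD
  set e := deriv (deriv c) 0 with he
  -- Inner products of difference quotients are mixed second differences of `c`, so they all tend to
  -- `-c''(0)`; expanding `‖D r - D k‖²` shows that the quotients are Cauchy.
  have hinner : ∀ r k : ℝ, r ≠ 0 → k ≠ 0 → ⟪D r, D k⟫_ℂ + e =
      ((r⁻¹ * k⁻¹ : ℝ) : ℂ) * (c (k - r) - c k - c (-r) + c 0 + (k * r : ℝ) * e) := by
    intro r k hr hk
    have hr' : (r : ℂ) ≠ 0 := by exact_mod_cast hr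
    have hk' : (k : ℂ) ≠ 0 := by exact_mod_cast hk
    simp only [hD]
    rw [← algebraMap_smul ℂ r⁻¹, ← algebraMap_smul ℂ k⁻¹, inner_smul_left, inner_smul_right]
    simp only [inner_sub_left, inner_sub_right, h, Complex.coe_algebraMap, Complex.conj_ofReal]
    rw [show t + k - (t + r) = k - r by ring, show t - (t + r) = -r by ring,
      add_sub_cancel_left, sub_self]
    push_cast
    field_simp
    ring
  have hcauchy : Cauchy (map D (𝓝[≠] 0)) := by
    refine Metric.cauchy_iff.2 ⟨inferInstance, fun ε hε => ?_⟩
    -- Four inner products enter `‖D r - D k‖²`, and `4 ε² / 5 < ε²`.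
    obtain ⟨δ, hδ, hb⟩ := exists_second_difference_bound hc (ε := ε ^ 2 / 5) (by positivity)
    have hb' : ∀ r k : ℝ, r ≠ 0 → k ≠ 0 → |r| < δ → |k| < δ →
        ‖⟪D r, D k⟫_ℂ + e‖ ≤ ε ^ 2 / 5 := by
      intro r k hr hk hr' hk'
      rw [hinner r k hr hk, norm_mul, Complex.norm_real, Real.norm_eq_abs, abs_mul, abs_inv,
        abs_inv]
      have h1 := abs_pos.2 hr
      have h2 := abs_pos.2 hk
      calc |r|⁻¹ * |k|⁻¹ * _ ≤ |r|⁻¹ * |k|⁻¹ * (ε ^ 2 / 5 * |r| * |k|) := by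
            gcongr
            exact hb r k hr' hk'
        _ = _ := by field_simp
    refine ⟨D '' ({0}ᶜ ∩ Metric.ball 0 δ), image_mem_map (inter_mem_nhdsWithin _
      (Metric.ball_mem_nhds _ hδ)), ?_⟩
    rintro _ ⟨r, ⟨hr, hr'⟩, rfl⟩ _ ⟨k, ⟨hk, hk'⟩, rfl⟩
    have hr' : |r| < δ := by simpa using hr'
    have hk' : |k| < δ := by simpa using hk'
    have hr : r ≠ 0 := hr
    have hk : k ≠ 0 := hk
    have hsq : ‖D r - D k‖ ^ 2 = ((⟪D r, D r⟫_ℂ + e) - (⟪D r, D k⟫_ℂ + e) -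
        (⟪D k, D r⟫_ℂ + e) + (⟪D k, D k⟫_ℂ + e)).re := by
      have : ((⟪D r, D r⟫_ℂ + e) - (⟪D r, D k⟫_ℂ + e) -
        (⟪D k, D r⟫_ℂ + e) + (⟪D k, D k⟫_ℂ + e)) = ⟪D r - D k, D r - D k⟫_ℂ := by
        simp only [inner_sub_left, inner_sub_right]; ring
      rw [this]
      exact (inner_self_eq_norm_sq (𝕜 := ℂ) _).symm
    have hle : ‖D r - D k‖ ^ 2 ≤ 4 * (ε ^ 2 / 5) := by
      rw [hsq]
      refine (Complex.re_le_norm _).trans ?_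
      refine (norm_add_le _ _).trans ?_
      have h1 := norm_sub_le ((⟪D r, D r⟫_ℂ + e) - (⟪D r, D k⟫_ℂ + e)) (⟪D k, D r⟫_ℂ + e)
      have h2 := norm_sub_le (⟪D r, D r⟫_ℂ + e) (⟪D r, D k⟫_ℂ + e)
      linarith [hb' r r hr hr hr' hr', hb' r k hr hk hr' hk', hb' k r hk hr hk' hr',
        hb' k k hk hk hk' hk']
    rw [dist_eq_norm]
    have : 0 < ε ^ 2 := by positivity
    exact lt_of_pow_lt_pow_left₀ 2 hε.le (by linarith)
  obtain ⟨x, hx⟩ := CompleteSpace.complete hcauchy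
  exact ⟨x, hasDerivAt_iff_tendsto_slope_zero.2 hx⟩

/-- The velocity again has a stationary correlation function, so the differentiability criterion can
be iterated. -/
lemma inner_deriv_deriv {u v : ℝ → K} {c : ℝ → ℂ} (hc : ContDiff ℝ 2 c)
    (h : ∀ s t, ⟪u s, u t⟫_ℂ = c (t - s)) (hv : ∀ t, HasDerivAt u (v t) t) (s t : ℝ) :
    ⟪v s, v t⟫_ℂ = -deriv (deriv c) (t - s) := by
  have hd1 : ContDiff ℝ 1 (deriv c) := by
    have := (contDiff_succ_iff_deriv (n := 1)).1 (by simpa using! hc)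
    exact this.2.2
  have hcd : Differentiable ℝ c := hc.differentiable (by norm_num)
  have hcd1 : Differentiable ℝ (deriv c) := hd1.differentiable (by norm_num)
  have h1 : ∀ s t, ⟪u s, v t⟫_ℂ = deriv c (t - s) := fun s t => by
    have e1 := (hasDerivAt_const t (u s)).inner ℂ (hv t)
    have e2 : HasDerivAt (fun t => c (t - s)) (deriv c (t - s)) t :=
      (hcd (t - s)).hasDerivAt.comp_sub_const t s
    simp only [h, inner_zero_left, add_zero] at e1
    exact e1.unique e2
  have e1 := (hv s).inner ℂ (hasDerivAt_const s (v t))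
  have e2 : HasDerivAt (fun s => deriv c (t - s)) (-deriv (deriv c) (t - s)) s :=
    (hcd1 (t - s)).hasDerivAt.comp_const_sub t s
  simp only [h1, inner_zero_right, zero_add] at e1
  exact e1.unique e2

end Curve

variable {n : ℕ}

lemma summable_norm_sq_of_tsum_enorm {ι E : Type*} [NormedAddCommGroup E] {a : ι → E}
    (hs : ∑' j, ‖a j‖ₑ ^ 2 < ∞) : Summable fun j => ‖a j‖ ^ 2 := by
  refine summable_of_tsum_enorm_lt_top (lt_of_eq_of_lt (tsum_congr fun j => ?_) hs)
  rw [enorm_pow, enorm_norm]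

/-- The curve `t ↦ (V(t g) aᵢ)ᵢ` of square summable families. -/
def weylCurve {ι : Type*} (g : Phase n) (a : ι → Hilb n) (ha : Summable fun i => ‖a i‖ ^ 2)
    (t : ℝ) : lp (fun _ : ι => Hilb n) 2 :=
  ⟨fun i => weyl (t • g) (a i), by
    refine memℓp_gen ?_
    simpa [norm_weyl_apply] using ha⟩

lemma weylCurve_apply {ι : Type*} (g : Phase n) (a : ι → Hilb n)
    (ha : Summable fun i => ‖a i‖ ^ 2) (t : ℝ) (i : ι) :
    weylCurve g a ha t i = weyl (t • g) (a i) := rfl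

/-- Unitarity and the group law turn each summand into `⟪aᵢ, V((t - s) g) aᵢ⟫`; these sum to the
characteristic function. -/
lemma inner_weylCurve {ι : Type*} {A : Op n} (g : Phase n) {a : ι → Hilb n}
    (hA : IsExpansion A a a) (hs : ∑' j, ‖a j‖ₑ * ‖a j‖ₑ < ∞)
    (ha : Summable fun i => ‖a i‖ ^ 2) (s t : ℝ) :
    ⟪weylCurve g a ha s, weylCurve g a ha t⟫_ℂ = charFun A ((t - s) • g) := by
  have h1 := lp.hasSum_inner (𝕜 := ℂ) (weylCurve g a ha s) (weylCurve g a ha t)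
  have h2 := hA.hasSum_charFun hs ((t - s) • g)
  refine h1.unique (h2.congr_fun fun i => ?_)
  rw [weylCurve_apply, weylCurve_apply, ← inner_weyl_weyl ((-s) • g) (weyl (s • g) _),
    weyl_smul_smul, weyl_smul_smul, neg_add_cancel, zero_smul, weyl_zero, neg_add_eq_sub]
  rfl

lemma summable_norm_sq_lp {ι : Type*} (x : lp (fun _ : ι => Hilb n) 2) :
    Summable fun i => ‖x i‖ ^ 2 := by
  have := (lp.memℓp x).summable (by norm_num)
  simpa using this

lemma norm_obsR_of_hasDerivAt {k : Fin n ⊕ Fin n} {φ χ : Hilb n}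
    (h : HasDerivAt (fun t : ℝ => weyl (t • genDir k) φ) χ 0) : ‖obsR k φ‖ = ‖χ‖ := by
  rw [obsR, h.deriv, norm_smul]
  simp

/-- If the characteristic function of `∑ᵢ |aᵢ⟩⟨aᵢ|` is smooth, then the `aᵢ` have square summable
second moments. -/
lemma IsExpansion.inDomR_and_summable {ι : Type*} {A : Op n} {a : ι → Hilb n}
    (hA : IsExpansion A a a) (hs : ∑' j, ‖a j‖ₑ * ‖a j‖ₑ < ∞) (k : Fin n ⊕ Fin n)
    (hc : ContDiff ℝ 4 fun t : ℝ => charFun A (t • genDir k)) :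
    (∀ i, InDomR k (a i) ∧ InDomR k (obsR k (a i))) ∧
      (Summable fun i => ‖obsR k (a i)‖ ^ 2) ∧
      Summable fun i => ‖obsR k (obsR k (a i))‖ ^ 2 := by
  have ha : Summable fun i => ‖a i‖ ^ 2 :=
    summable_norm_sq_of_tsum_enorm (by simpa only [pow_two] using hs)
  set c : ℝ → ℂ := fun t => charFun A (t • genDir k) with hcdef
  set u := weylCurve (genDir k) a ha with hu
  have hc2 : ContDiff ℝ 2 c := hc.of_le (by norm_num)
  have hc'' : ContDiff ℝ 2 fun t => -deriv (deriv c) t := by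
    have h1 : ContDiff ℝ 3 (deriv c) :=
      ((contDiff_succ_iff_deriv (n := 3)).1 (by simpa using! hc)).2.2
    have h2 : ContDiff ℝ 2 (deriv (deriv c)) :=
      ((contDiff_succ_iff_deriv (n := 2)).1 (by simpa using! h1)).2.2
    exact h2.neg
  have hin : ∀ s t, ⟪u s, u t⟫_ℂ = c (t - s) := inner_weylCurve _ hA hs ha
  choose v hv using exists_hasDerivAt_of_inner_eq hc2 hin
  have hvin := inner_deriv_deriv hc2 hin hv
  obtain ⟨w, hw⟩ := exists_hasDerivAt_of_inner_eq hc'' hvin 0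
  have hvi : ∀ i t, HasDerivAt (fun t : ℝ => weyl (t • genDir k) (a i)) (v t i) t := fun i t =>
    -- Coordinates are continuous on `ℓ²`, so each `aᵢ` inherits the derivatives, while `v 0` and
    -- `w` being in `ℓ²` is the square summability claimed.
    (lp.evalCLM ℝ (fun _ : ι => Hilb n) 2 i).hasFDerivAt.comp_hasDerivAt t (hv t)
  have hwi : ∀ i, HasDerivAt (fun t : ℝ => v t i) (w i) 0 := fun i =>
    (lp.evalCLM ℝ (fun _ : ι => Hilb n) 2 i).hasFDerivAt.comp_hasDerivAt 0 hw
  have hdom : ∀ i, InDomR k (a i) := fun i => (hvi i 0).differentiableAt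
  have hRi : ∀ i, HasDerivAt (fun t : ℝ => weyl (t • genDir k) (obsR k (a i)))
      ((-Complex.I) • w i) 0 := fun i => by
    refine ((hwi i).const_smul (-Complex.I)).congr_of_eventuallyEq (Eventually.of_forall fun t => ?_)
    have := (hvi i t).unique ((hdom i).hasDerivAt' t)
    simp only [this, Pi.smul_apply, smul_smul]
    simp
  refine ⟨fun i => ⟨hdom i, (hRi i).differentiableAt⟩, ?_, ?_⟩
  · refine (summable_norm_sq_lp (v 0)).congr fun i => ?_
    rw [norm_obsR_of_hasDerivAt (hvi i 0)]
  · refine (summable_norm_sq_lp w).congr fun i => ?_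
    rw [norm_obsR_of_hasDerivAt (hRi i), norm_smul]
    simp

end QuantumDiffusion

/-! ### Approximation by vectors with `C²` representatives -/

namespace QuantumDiffusion

variable {n : ℕ}

/-- The domain of each observable is invariant under the Weyl operators. -/
lemma InDomR.weyl {k : Fin n ⊕ Fin n} {φ : Hilb n} (hφ : InDomR k φ) (z : Phase n) :
    InDomR k (weyl z φ) ∧
      obsR k (weyl z φ) = QuantumDiffusion.weyl z (obsR k φ) -
        (z k : ℂ) • QuantumDiffusion.weyl z φ := by
  apply inDomR_of_hasDerivAt
  have hexp : HasDerivAt (fun t : ℝ => Complex.exp (-(Complex.I * ((t * z k : ℝ) : ℂ))))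
      (-(Complex.I * z k)) 0 := by
    have h : HasDerivAt (fun t : ℝ => -(Complex.I * ((t * z k : ℝ) : ℂ)))
        (-(Complex.I * ((1 * z k : ℝ) : ℂ))) 0 :=
      ((((hasDerivAt_id (0 : ℝ)).mul_const (z k)).ofReal_comp).const_mul _).neg
    simpa using h.cexp
  have h1 := ((QuantumDiffusion.weyl z).restrictScalars ℝ).hasFDerivAt.comp_hasDerivAt
    (0 : ℝ) hφ.hasDerivAt
  have h2 := hexp.smul h1
  have h3 : (Complex.I • (QuantumDiffusion.weyl z (obsR k φ) -
      (z k : ℂ) • QuantumDiffusion.weyl z φ)) =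
      Complex.exp (-(Complex.I * ((0 * z k : ℝ) : ℂ))) •
        (QuantumDiffusion.weyl z) (Complex.I • obsR k φ) +
      (-(Complex.I * (z k : ℂ))) • (QuantumDiffusion.weyl z)
        (QuantumDiffusion.weyl ((0 : ℝ) • genDir k) φ) := by
    rw [zero_mul, zero_smul, weyl_zero, Complex.ofReal_zero, mul_zero, neg_zero, Complex.exp_zero,
      one_smul, map_smul, one_apply_eq_self, smul_sub, smul_smul, neg_smul, sub_eq_add_neg]
  rw [h3]
  refine h2.congr_of_eventuallyEq (Eventually.of_forall fun t => ?_)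
  simp only [Function.comp_def, ContinuousLinearMap.coe_restrictScalars', Pi.smul_apply']
  rw [weyl_weyl_genDir, smul_smul, ← Complex.exp_add, neg_add_cancel, Complex.exp_zero, one_smul]

/-! ### Mollification -/

/-- The average `∫ η(x) V(x, 0) φ dx` of translates of `φ`. -/
def mollify (η : Config n → ℂ) (φ : Hilb n) : Hilb n := ∫ x, η x • weyl (phasePoint x 0) φ

lemma continuous_weyl_phasePoint (φ : Hilb n) :
    Continuous fun x : Config n => weyl (phasePoint x 0) φ :=
  (continuous_weyl_apply φ).comp
    (continuous_phasePoint.comp (continuous_id.prodMk continuous_const))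

lemma integrable_mollify {η : Config n → ℂ} (hη : Continuous η) (hc : HasCompactSupport η)
    (φ : Hilb n) : Integrable fun x => η x • weyl (phasePoint x 0) φ :=
  (hη.smul (continuous_weyl_phasePoint φ)).integrable_of_hasCompactSupport hc.smul_right

/-- The coordinate `k` of the phase space point `(x, 0)`. -/
def posCoord (k : Fin n ⊕ Fin n) (x : Config n) : ℂ := ((phasePoint x 0 : Phase n) k : ℝ)

lemma continuous_posCoord (k : Fin n ⊕ Fin n) : Continuous (posCoord (n := n) k) :=
  Complex.continuous_ofReal.comp ((EuclideanSpace.proj (𝕜 := ℝ) k).continuous.comp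
    (continuous_phasePoint.comp
      (continuous_id.prodMk (continuous_const (X := Config n) (y := (0 : Config n))))))

lemma posCoord_zero (k : Fin n ⊕ Fin n) : posCoord k (0 : Config n) = 0 := by
  cases k <;> simp [posCoord, phasePoint]

/-- Moving `R_k` past `V(x, 0)` costs the coordinate `k` of `(x, 0)`, so the commutator with
mollification is mollification by a kernel carrying a factor that vanishes at the origin. Unitarity
makes the dominating function independent of `t`. -/
lemma inDomR_mollify {k : Fin n ⊕ Fin n} {η : Config n → ℂ} (hη : Continuous η)
    (hc : HasCompactSupport η) {φ : Hilb n} (hφ : InDomR k φ) :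
    InDomR k (mollify η φ) ∧ obsR k (mollify η φ) =
      mollify η (obsR k φ) - mollify (fun x => posCoord k x * η x) φ := by
  apply inDomR_of_hasDerivAt
  set G : Config n → Hilb n := fun x => weyl (phasePoint x 0) (obsR k φ) -
    posCoord k x • weyl (phasePoint x 0) φ with hG
  have hGc : Continuous G := (continuous_weyl_phasePoint _).sub
    ((continuous_posCoord k).smul (continuous_weyl_phasePoint _))
  have hdom : ∀ x, InDomR k (weyl (phasePoint x 0) φ) ∧
      obsR k (weyl (phasePoint x 0) φ) = G x := fun x => hφ.weyl (phasePoint x 0)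
  have hmeas : ∀ (t : ℝ) (F : Config n → Hilb n), Continuous F →
      AEStronglyMeasurable (fun x => η x • weyl (t • genDir k) (F x)) volume := fun t F hF =>
    (hη.smul ((weyl (t • genDir k)).continuous.comp hF)).aestronglyMeasurable
  have hint : ∀ F : Config n → Hilb n, Continuous F → Integrable fun x => η x • F x := fun F hF =>
    (hη.smul hF).integrable_of_hasCompactSupport hc.smul_right
  have key := hasDerivAt_integral_of_dominated_loc_of_deriv_le (μ := (volume : Measure (Config n)))
    (F := fun (t : ℝ) x => η x • weyl (t • genDir k) (weyl (phasePoint x 0) φ))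
    (F' := fun (t : ℝ) x => η x • (Complex.I • weyl (t • genDir k) (G x)))
    (x₀ := 0) (s := Set.univ) (bound := fun x => ‖η x • G x‖) univ_mem
    (Eventually.of_forall fun t => hmeas t _ (continuous_weyl_phasePoint φ))
    (by simpa [weyl_zero] using integrable_mollify hη hc φ)
    (by
      simp_rw [smul_comm (η _) Complex.I]
      exact (hmeas 0 G hGc).const_smul Complex.I)
    (Eventually.of_forall fun x t _ => by
      rw [norm_smul, norm_smul, Complex.norm_I, one_mul, norm_weyl_apply, norm_smul])
    (hint G hGc).norm
    (Eventually.of_forall fun x t _ => by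
      have := ((hdom x).1.hasDerivAt' t).const_smul (η x)
      rw [(hdom x).2] at this
      exact this)
  have h1 := key.2
  have h2 : (∫ x, η x • (Complex.I • weyl ((0 : ℝ) • genDir k) (G x))) = Complex.I •
      (mollify η (obsR k φ) - mollify (fun x => posCoord k x * η x) φ) := by
    simp only [zero_smul, weyl_zero, one_apply_eq_self]
    simp_rw [smul_comm (η _) Complex.I]
    rw [integral_smul]
    congr 1
    rw [mollify, mollify, ← integral_sub (integrable_mollify hη hc _)]
    · refine integral_congr_ae (Eventually.of_forall fun x => ?_)
      simp only [hG, smul_sub, smul_smul]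
      rw [mul_comm]
    · exact integrable_mollify ((continuous_posCoord k).mul hη) hc.mul_left _
  rw [h2] at h1
  refine h1.congr_of_eventuallyEq (Eventually.of_forall fun t => ?_)
  simp only [mollify]
  rw [← ContinuousLinearMap.integral_comp_comm _ (integrable_mollify hη hc φ)]
  simp only [map_smul]

/-- A shrinking sequence of bump functions. -/
def shrinkingBump (n m : ℕ) : ContDiffBump (0 : Config n) where
  rIn := 1 / (2 * (m + 1))
  rOut := 1 / (m + 1)
  rIn_pos := by positivity
  rIn_lt_rOut := by
    rw [div_lt_div_iff₀ (by positivity) (by positivity)]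
    have : (0 : ℝ) ≤ m := Nat.cast_nonneg m
    linarith

/-- A smooth approximate identity. -/
def approxId (n m : ℕ) (x : Config n) : ℂ := ((shrinkingBump n m).normed volume x : ℝ)

lemma continuous_approxId (n m : ℕ) : Continuous (approxId n m) :=
  Complex.continuous_ofReal.comp (shrinkingBump n m).continuous_normed

lemma hasCompactSupport_approxId (n m : ℕ) : HasCompactSupport (approxId n m) :=
  (shrinkingBump n m).hasCompactSupport_normed.comp_left Complex.ofReal_zero

lemma tendsto_integral_approxId_smul {F : Config n → Hilb n} (hF : Continuous F) :
    Tendsto (fun m => ∫ x, approxId n m x • F x) atTop (𝓝 (F 0)) := by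
  rw [Metric.tendsto_atTop]
  intro ε hε
  obtain ⟨δ, hδ, hball⟩ := Metric.continuousAt_iff.1 (hF.continuousAt (x := 0)) (ε / 2) (half_pos hε)
  obtain ⟨N, hN⟩ := exists_nat_one_div_lt hδ
  refine ⟨N, fun m hm => ?_⟩
  have hm' : (1 : ℝ) / (m + 1) < δ := by
    refine lt_of_le_of_lt ?_ hN
    have : (N : ℝ) ≤ m := by exact_mod_cast hm
    gcongr
  have hone : ∫ x, approxId n m x = 1 := by
    simp only [approxId]
    rw [integral_complex_ofReal, (shrinkingBump n m).integral_normed, Complex.ofReal_one]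
  have hint : ∀ F : Config n → Hilb n, Continuous F → Integrable fun x => approxId n m x • F x :=
    fun F hF => ((continuous_approxId n m).smul hF).integrable_of_hasCompactSupport
      (hasCompactSupport_approxId n m).smul_right
  have h1 : (∫ x, approxId n m x • F x) - F 0 = ∫ x, approxId n m x • (F x - F 0) := by
    simp_rw [smul_sub]
    rw [integral_sub (hint F hF) (hint _ continuous_const), integral_smul_const, hone, one_smul]
  rw [dist_eq_norm, h1]
  refine (norm_integral_le_of_norm_le (g := fun x => (shrinkingBump n m).normed volume x * (ε / 2))
    ((shrinkingBump n m).integrable_normed.mul_const _) (Eventually.of_forall fun x => ?_)).trans_lt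
    ?_
  · have hnn := (shrinkingBump n m).nonneg_normed (μ := volume) x
    rw [norm_smul, approxId, Complex.norm_real, Real.norm_of_nonneg hnn]
    by_cases hx : x ∈ Metric.ball (0 : Config n) (shrinkingBump n m).rOut
    · gcongr
      rw [← dist_eq_norm]
      exact (hball ((Metric.mem_ball.1 hx).trans hm')).le
    · rw [← (shrinkingBump n m).support_normed_eq (μ := volume), Function.notMem_support] at hx
      rw [hx, zero_mul, zero_mul]
  · rw [integral_mul_const, (shrinkingBump n m).integral_normed, one_mul]
    linarith

lemma tendsto_mollify {g : Config n → ℂ} (hg : Continuous g) (φ : Hilb n) :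
    Tendsto (fun m => mollify (fun x => g x * approxId n m x) φ) atTop (𝓝 (g 0 • φ)) := by
  have h := tendsto_integral_approxId_smul (hg.smul (continuous_weyl_phasePoint φ))
  have h0 : phasePoint (0 : Config n) 0 = (0 : Phase n) := by
    ext i; cases i <;> rfl
  have h1 : (g • fun x : Config n => weyl (phasePoint x 0) φ) 0 = g 0 • φ := by
    change g 0 • weyl (phasePoint 0 0) φ = _
    rw [h0, weyl_zero, one_apply_eq_self]
  rw [← h1]
  refine h.congr fun m => ?_
  rw [mollify]
  refine integral_congr_ae (Eventually.of_forall fun x => ?_)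
  change approxId n m x • (g x • weyl (phasePoint x 0) φ) = _
  rw [smul_smul, mul_comm]

lemma enorm_mul_le_sq_add_sq (a b : ℝ≥0∞) : a * b ≤ a ^ 2 + b ^ 2 := by
  rcases le_total a b with h | h
  · calc a * b ≤ b * b := by gcongr
      _ = b ^ 2 := (pow_two b).symm
      _ ≤ _ := le_add_self
  · calc a * b ≤ a * a := by gcongr
      _ = a ^ 2 := (pow_two a).symm
      _ ≤ _ := le_self_add

/-- Fubini hypothesis for `exists_contDiff_mollify`; the product `s · φ(· + x)` is bounded in `L¹`
uniformly in `x` by `ab ≤ a² + b²`. -/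
lemma integrable_mul_mul_translate {f s : Config n → ℝ} (hf : Continuous f)
    (hfc : HasCompactSupport f) (hs : Continuous s) (hsc : HasCompactSupport s) (φ : Hilb n) :
    Integrable (Function.uncurry fun x y : Config n => (f x : ℂ) * ((s y : ℂ) * φ (y + x)))
      ((volume : Measure (Config n)).prod volume) := by
  have hmφ := (Lp.stronglyMeasurable φ).measurable
  have hm : Measurable (Function.uncurry fun x y : Config n =>
      (f x : ℂ) * ((s y : ℂ) * φ (y + x))) := by
    simp only [Function.uncurry_def]
    have h1 : Measurable fun y : Config n × Config n => φ (y.2 + y.1) :=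
      hmφ.comp (measurable_snd.add measurable_fst)
    have h2 : Measurable fun y : Config n × Config n => (f y.1 : ℂ) :=
      (Complex.continuous_ofReal.comp (hf.comp continuous_fst)).measurable
    have h3 : Measurable fun y : Config n × Config n => (s y.2 : ℂ) :=
      (Complex.continuous_ofReal.comp (hs.comp continuous_snd)).measurable
    exact h2.mul (h3.mul h1)
  refine ⟨hm.aestronglyMeasurable, ?_⟩
  have hs2 : MemLp (fun y => (s y : ℂ)) 2 (volume : Measure (Config n)) :=
    (Complex.continuous_ofReal.comp hs).memLp_of_hasCompactSupport
      (hsc.comp_left Complex.ofReal_zero)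
  have hsm : Measurable fun y : Config n => ‖(s y : ℂ)‖ₑ ^ 2 :=
    (Complex.continuous_ofReal.comp hs).enorm.measurable.pow_const 2
  rw [HasFiniteIntegral, lintegral_prod _ hm.enorm.aemeasurable]
  simp only [Function.uncurry_apply_pair]
  calc ∫⁻ x, ∫⁻ y, ‖(f x : ℂ) * ((s y : ℂ) * φ (y + x))‖ₑ
      ≤ ∫⁻ x, ‖(f x : ℂ)‖ₑ * (eLpNorm (fun y => (s y : ℂ)) 2 volume ^ 2 + ‖φ‖ₑ ^ 2) := by
        refine lintegral_mono fun x => ?_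
        simp only [enorm_mul (f x : ℂ)]
        rw [lintegral_const_mul']
        swap
        · exact enorm_ne_top
        gcongr
        rw [eLpNorm_two_sq, enorm_sq_eq_lintegral φ,
          ← lintegral_add_right_eq_self (fun y => ‖φ y‖ₑ ^ 2) x, ← lintegral_add_left hsm]
        refine lintegral_mono fun y => ?_
        rw [enorm_mul]
        exact enorm_mul_le_sq_add_sq _ _
    _ = (∫⁻ x, ‖(f x : ℂ)‖ₑ) * (eLpNorm (fun y => (s y : ℂ)) 2 volume ^ 2 + ‖φ‖ₑ ^ 2) := by
        rw [lintegral_mul_const]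
        exact (Complex.continuous_ofReal.comp hf).enorm.measurable
    _ < ∞ := by
        have h1 : Integrable (fun x => (f x : ℂ)) :=
          (Complex.continuous_ofReal.comp hf).integrable_of_hasCompactSupport
            (hfc.comp_left Complex.ofReal_zero)
        refine ENNReal.mul_lt_top h1.2 (ENNReal.add_lt_top.2 ⟨?_, ?_⟩)
        · exact ENNReal.pow_lt_top hs2.2
        · exact ENNReal.pow_lt_top enorm_lt_top

lemma weylPhase_phasePoint_zero (x y : Config n) : weylPhase (phasePoint x 0) y = 1 := by
  simp [weylPhase]

/-- Mollified vectors have smooth representatives. -/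
lemma exists_contDiff_mollify {f : Config n → ℝ} (hf : ContDiff ℝ 2 f) (hfc : HasCompactSupport f)
    (φ : Hilb n) : ∃ h : Config n → ℂ, ContDiff ℝ 2 h ∧
      (mollify (fun x => (f x : ℂ)) φ : Config n → ℂ) =ᵐ[volume] h := by
  have hφloc : LocallyIntegrable φ (volume : Measure (Config n)) :=
    (Lp.memLp φ).locallyIntegrable one_le_two
  have hneg : HasCompactSupport fun x => f (-x) :=
    hfc.comp_homeomorph (Homeomorph.neg (Config n))
  -- `V(x, 0)` sends `φ` to `φ(· + x)`, hence the reflection of `f`. The Bochner integral in `L²` is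
  -- then matched with this pointwise integral by pairing with test functions.
  set h : Config n → ℂ := MeasureTheory.convolution (fun x => f (-x)) φ
    (ContinuousLinearMap.lsmul ℝ ℝ) volume with hh
  have hsmooth : ContDiff ℝ 2 h :=
    hneg.contDiff_convolution_left (n := 2) _ (hf.comp contDiff_neg) hφloc
  have hval : ∀ y, h y = ∫ x, (f x : ℂ) * φ (y + x) := fun y => by
    rw [hh, MeasureTheory.convolution_def, ← integral_neg_eq_self]
    refine integral_congr_ae (Eventually.of_forall fun x => ?_)
    simp
  refine ⟨h, hsmooth, ?_⟩
  refine ae_eq_of_integral_contDiff_smul_eq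
    ((Lp.memLp (mollify (fun x => (f x : ℂ)) φ)).locallyIntegrable one_le_two)
    hsmooth.continuous.locallyIntegrable ?_
  intro s hs hsc
  have hfC : Continuous fun x => (f x : ℂ) := Complex.continuous_ofReal.comp hf.continuous
  have hfCc : HasCompactSupport fun x => (f x : ℂ) := hfc.comp_left Complex.ofReal_zero
  have hs2 : MemLp (fun y => (s y : ℂ)) 2 (volume : Measure (Config n)) :=
    (Complex.continuous_ofReal.comp hs.continuous).memLp_of_hasCompactSupport
      (hsc.comp_left Complex.ofReal_zero)
  have hpair : ∀ ψ : Hilb n, ∫ y, s y • ψ y = ⟪hs2.toLp _, ψ⟫_ℂ := fun ψ => by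
    rw [L2.inner_def]
    refine integral_congr_ae ?_
    filter_upwards [hs2.coeFn_toLp] with y hy
    rw [hy, RCLike.inner_apply, Complex.conj_ofReal, Complex.real_smul, mul_comm]
  have hw : ∀ x, ⟪hs2.toLp _, weyl (phasePoint x 0) φ⟫_ℂ = ∫ y, (s y : ℂ) * φ (y + x) :=
    fun x => by
    rw [← hpair]
    refine integral_congr_ae ?_
    filter_upwards [weyl_apply_ae (phasePoint x 0) φ] with y hy
    rw [hy, weylPhase_phasePoint_zero, one_mul, Complex.real_smul, qPart_phasePoint]
  rw [hpair, mollify, ← integral_inner (integrable_mollify hfC hfCc φ)]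
  simp_rw [inner_smul_right, hw, ← integral_const_mul]
  rw [integral_integral_swap
    (integrable_mul_mul_translate hf.continuous hfc hs.continuous hsc φ)]
  refine integral_congr_ae (Eventually.of_forall fun y => ?_)
  simp only
  rw [hval, Complex.real_smul, ← integral_const_mul]
  refine integral_congr_ae (Eventually.of_forall fun x => ?_)
  simp only
  ring

/-- Vectors with two moments are approximated, together with these moments, by vectors in the
domain used for the initial domain of the generator. -/
lemma exists_seq_vectorDomain {φ : Hilb n}
    (hφ : ∀ k, InDomR k φ ∧ InDomR k (obsR k φ)) :
    ∃ u : ℕ → Hilb n, (∀ m, u m ∈ vectorDomain n) ∧ Tendsto u atTop (𝓝 φ) ∧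
      (∀ k, Tendsto (fun m => obsR k (u m)) atTop (𝓝 (obsR k φ))) ∧
      ∀ k, Tendsto (fun m => obsR k (obsR k (u m))) atTop (𝓝 (obsR k (obsR k φ))) := by
  have hc := continuous_approxId n
  have hs := hasCompactSupport_approxId n
  have hpc : ∀ k m, Continuous fun x => posCoord k x * approxId n m x := fun k m =>
    (continuous_posCoord k).mul (hc m)
  have hps : ∀ k m, HasCompactSupport fun x => posCoord k x * approxId n m x := fun k m =>
    (hs m).mul_left
  have h0 : ∀ ψ : Hilb n, Tendsto (fun m => mollify (approxId n m) ψ) atTop (𝓝 ψ) := fun ψ => by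
    simpa using tendsto_mollify (g := fun _ => 1) continuous_const ψ
  have h1 : ∀ k (ψ : Hilb n), Tendsto
      (fun m => mollify (fun x => posCoord k x * approxId n m x) ψ) atTop (𝓝 0) := fun k ψ => by
    simpa [posCoord_zero] using tendsto_mollify (continuous_posCoord k) ψ
  have h2 : ∀ k (ψ : Hilb n), Tendsto
      (fun m => mollify (fun x => posCoord k x * (posCoord k x * approxId n m x)) ψ) atTop
      (𝓝 0) := fun k ψ => by
    simpa [posCoord_zero, mul_assoc] using
      tendsto_mollify ((continuous_posCoord k).mul (continuous_posCoord k)) ψ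
  -- Applying `R_k` twice leaves mollifications of `R_k² φ`, plus errors whose kernels carry one or
  -- two factors `posCoord k` and hence tend to zero.
  have hd := fun k m => inDomR_mollify (k := k) (hc m) (hs m) (hφ k).1
  have hd' := fun k m => inDomR_mollify (k := k) (hc m) (hs m) (hφ k).2
  have hd'' := fun k m => inDomR_mollify (k := k) (hpc k m) (hps k m) (hφ k).1
  have hRR := fun k m => (hd' k m).1.add_smul (hd'' k m).1 1 (-1)
  simp only [one_smul, neg_smul, ← sub_eq_add_neg] at hRR
  refine ⟨fun m => mollify (approxId n m) φ, fun m => ⟨?_, fun k => ⟨(hd k m).1, ?_⟩⟩, h0 φ,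
    fun k => ?_, fun k => ?_⟩
  · exact exists_contDiff_mollify (shrinkingBump n m).contDiff_normed
      (shrinkingBump n m).hasCompactSupport_normed φ
  · rw [(hd k m).2]
    exact (hRR k m).1
  · simp_rw [(hd k _).2]
    simpa using (h0 (obsR k φ)).sub (h1 k φ)
  · simp_rw [(hd k _).2, (hRR k _).2, (hd' k _).2, (hd'' k _).2]
    simpa using ((h0 (obsR k (obsR k φ))).sub (h1 k (obsR k φ))).sub
      ((h1 k (obsR k φ)).sub (h2 k φ))

end QuantumDiffusion

/-! ### Trace norm limits and membership in the domain of the generator -/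

namespace QuantumDiffusion

open InnerProductSpace (rankOne)

/-! ### Convergence in trace norm -/

section TraceTendsto

variable {H : Type*} [NormedAddCommGroup H] [InnerProductSpace ℂ H] [CompleteSpace H]
  {α ι : Type*} {l : Filter α} {T S : α → H →L[ℂ] H} {A B : H →L[ℂ] H}

/-- Convergence in trace norm. -/
def TraceTendsto (T : α → H →L[ℂ] H) (l : Filter α) (A : H →L[ℂ] H) : Prop :=
  Tendsto (fun m => traceNorm (T m - A)) l (𝓝 0)

lemma traceTendsto_of_le {f : α → ℝ≥0∞} (hf : Tendsto f l (𝓝 0))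
    (h : ∀ m, traceNorm (T m - A) ≤ f m) : TraceTendsto T l A :=
  tendsto_of_tendsto_of_tendsto_of_le_of_le tendsto_const_nhds hf (fun _ => zero_le) h

lemma TraceTendsto.add (h : TraceTendsto T l A) (h' : TraceTendsto S l B) :
    TraceTendsto (fun m => T m + S m) l (A + B) := by
  have h0 := Tendsto.add (M := ℝ≥0∞) h h'
  rw [add_zero] at h0
  refine traceTendsto_of_le h0 fun m => ?_
  rw [add_sub_add_comm]
  exact traceNorm_add_le _ _

lemma TraceTendsto.smul (h : TraceTendsto T l A) (c : ℂ) :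
    TraceTendsto (fun m => c • T m) l (c • A) := by
  have h0 : Tendsto (fun m => ‖c‖ₑ * traceNorm (T m - A)) l (𝓝 0) := by
    simpa using ENNReal.Tendsto.const_mul h (Or.inr enorm_ne_top)
  refine traceTendsto_of_le h0 fun m => ?_
  rw [← smul_sub]
  exact traceNorm_smul_le _ _

lemma TraceTendsto.sub (h : TraceTendsto T l A) (h' : TraceTendsto S l B) :
    TraceTendsto (fun m => T m - S m) l (A - B) := by
  simpa [sub_eq_add_neg] using h.add (h'.smul (-1))

lemma traceTendsto_sum (s : Finset ι) {T : ι → α → H →L[ℂ] H} {A : ι → H →L[ℂ] H}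
    (h : ∀ i ∈ s, TraceTendsto (T i) l (A i)) :
    TraceTendsto (fun m => ∑ i ∈ s, T i m) l (∑ i ∈ s, A i) := by
  have h0 : Tendsto (fun m => ∑ i ∈ s, traceNorm (T i m - A i)) l (𝓝 0) := by
    simpa using tendsto_finsetSum s h
  refine traceTendsto_of_le h0 fun m => ?_
  rw [← Finset.sum_sub_distrib]
  exact traceNorm_sum_le _ _

lemma traceTendsto_rankOne {a b : α → H} {φ ψ : H} (ha : Tendsto a l (𝓝 φ))
    (hb : Tendsto b l (𝓝 ψ)) : TraceTendsto (fun m => rankOne ℂ (a m) (b m)) l (rankOne ℂ φ ψ) := by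
  have h1 : Tendsto (fun m => ‖a m - φ‖ₑ) l (𝓝 0) := by
    simpa using (ha.sub_const φ).enorm
  have h2 : Tendsto (fun m => ‖b m - ψ‖ₑ) l (𝓝 0) := by
    simpa using (hb.sub_const ψ).enorm
  have h3 : Tendsto (fun m => ‖a m - φ‖ₑ * ‖b m‖ₑ + ‖φ‖ₑ * ‖b m - ψ‖ₑ) l (𝓝 0) := by
    simpa using (ENNReal.Tendsto.mul h1 (Or.inr enorm_ne_top) hb.enorm
      (Or.inr ENNReal.zero_ne_top)).add (ENNReal.Tendsto.const_mul h2 (Or.inr enorm_ne_top))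
  refine traceTendsto_of_le h3 fun m => ?_
  have h4 : rankOne ℂ (a m) (b m) - rankOne ℂ φ ψ =
      rankOne ℂ (a m - φ) (b m) + rankOne ℂ φ (b m - ψ) := by
    simp [map_sub, sub_add_sub_cancel]
  rw [h4]
  exact (traceNorm_add_le _ _).trans (add_le_add (traceNorm_rankOne_le _ _)
    (traceNorm_rankOne_le _ _))

lemma exists_isExpansion_of_tsum_lt_top {a b : ι → H} (hs : ∑' i, ‖a i‖ₑ * ‖b i‖ₑ < ∞) :
    ∃ A : H →L[ℂ] H, IsExpansion A a b := by
  have hsum : Summable fun i => rankOne ℂ (a i) (b i) := by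
    refine summable_of_tsum_enorm_lt_top (lt_of_le_of_lt (ENNReal.tsum_le_tsum fun i => ?_) hs)
    rw [← ofReal_norm, InnerProductSpace.norm_rankOne, ENNReal.ofReal_mul (norm_nonneg _),
      ofReal_norm, ofReal_norm]
  refine ⟨∑' i, rankOne ℂ (a i) (b i), fun x => ?_⟩
  simpa using hsum.hasSum.mapL (ContinuousLinearMap.apply ℂ H x)

/-- The remainder after a finite partial sum is expanded by the omitted terms, so its trace norm is
at most the tail of a convergent series. -/
lemma IsExpansion.traceTendsto {a b : ι → H} (h : IsExpansion A a b)
    (hs : ∑' i, ‖a i‖ₑ * ‖b i‖ₑ < ∞) :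
    TraceTendsto (fun F : Finset ι => ∑ i ∈ F, rankOne ℂ (a i) (b i)) atTop A := by
  refine traceTendsto_of_le (ENNReal.tendsto_tsum_compl_atTop_zero hs.ne) fun F => ?_
  rw [← traceNorm_neg, neg_sub]
  refine IsExpansion.traceNorm_le (a := fun i : {i // i ∉ F} => a i) (b := fun i => b i)
    fun x => ?_
  rw [F.hasSum_compl_iff (f := fun i => ⟪b i, x⟫_ℂ • a i)]
  simpa using h x

lemma tsum_enorm_mul_lt_top {a b : ι → H} (ha : Summable fun i => ‖a i‖ ^ 2)
    (hb : Summable fun i => ‖b i‖ ^ 2) : ∑' i, ‖a i‖ₑ * ‖b i‖ₑ < ∞ := by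
  have key : ∀ {c : ι → H}, (Summable fun i => ‖c i‖ ^ 2) → ∑' i, ‖c i‖ₑ ^ 2 < ∞ := by
    intro c hc
    simp_rw [← ofReal_norm, ← ENNReal.ofReal_pow (norm_nonneg _)]
    rw [← ENNReal.ofReal_tsum_of_nonneg (fun i => by positivity) hc]
    exact ENNReal.ofReal_lt_top
  refine lt_of_le_of_lt (ENNReal.tsum_le_tsum fun i => enorm_mul_le_sq_add_sq ‖a i‖ₑ ‖b i‖ₑ) ?_
  rw [ENNReal.tsum_add]
  exact ENNReal.add_lt_top.2 ⟨key ha, key hb⟩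

/-- A positive operator `A` has an expansion `∑ⱼ |aⱼ⟩⟨aⱼ|` with `∑ⱼ ‖aⱼ‖² = Tr A`. -/
lemma exists_isExpansion_self (hA : 0 ≤ A) :
    ∃ a : basisSet H → H, IsExpansion A a a ∧ ∑' i, ‖a i‖ₑ ^ 2 = posTrace A :=
  ⟨_, isExpansion_sqrt hA, (posTrace_eq_tsum_sqrt hA).symm⟩

end TraceTendsto

/-! ### Schwartz states are in the domain of the generator -/

variable {n : ℕ}

/-- `(T, U)` is in the trace norm closure of the initial graph of the generator. -/
def InClosure (T U : Op n) : Prop :=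
  ∀ δ : ℝ≥0∞, 0 < δ → ∃ T' U', InitialGenerator T' U' ∧ traceNorm (T' - T) < δ ∧
    traceNorm (U' - U) < δ

lemma InitialGenerator.inClosure {T U : Op n} (h : InitialGenerator T U) : InClosure T U :=
  fun δ hδ => ⟨T, U, h, by simpa [traceNorm_zero], by simpa [traceNorm_zero]⟩

/-- The closure is closed, along arbitrary filters. This allows the mollification limit and the
limit over finite subsets to be taken one after the other without diagonal sequences. -/
lemma inClosure_of_traceTendsto {α : Type*} {l : Filter α} [l.NeBot] {T U : α → Op n} {A B : Op n}
    (h : ∀ m, InClosure (T m) (U m)) (hT : TraceTendsto T l A) (hU : TraceTendsto U l B) :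
    InClosure A B := fun δ hδ => by
  have hδ2 : 0 < δ / 2 := ENNReal.half_pos hδ.ne'
  obtain ⟨m, hm, hm'⟩ := ((hT.eventually_lt_const hδ2).and (hU.eventually_lt_const hδ2)).exists
  obtain ⟨T', U', hI, h1, h2⟩ := h m (δ / 2) hδ2
  refine ⟨T', U', hI, ?_, ?_⟩
  · rw [← sub_add_sub_cancel T' (T m), ← ENNReal.add_halves δ]
    exact (traceNorm_add_le _ _).trans_lt (ENNReal.add_lt_add h1 hm)
  · rw [← sub_add_sub_cancel U' (U m), ← ENNReal.add_halves δ]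
    exact (traceNorm_add_le _ _).trans_lt (ENNReal.add_lt_add h2 hm')

lemma InClosure.generatorGraph {ρ σ : Op n} (h : InClosure ρ σ) (hρ : IsTraceClass ρ)
    (hσ : IsTraceClass σ) : GeneratorGraph ρ σ := by
  choose T U hI hT hU using fun m : ℕ => h ((m : ℝ≥0∞)⁻¹) (by simp)
  exact ⟨hρ, hσ, T, U, hI,
    traceTendsto_of_le ENNReal.tendsto_inv_nat_nhds_zero fun m => (hT m).le,
    traceTendsto_of_le ENNReal.tendsto_inv_nat_nhds_zero fun m => (hU m).le⟩

lemma initialGenerator_sum_rankOne {ι : Type*} (F : Finset ι) {v : ι → Hilb n}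
    (hv : ∀ i, v i ∈ vectorDomain n) :
    InitialGenerator (∑ i ∈ F, rankOne ℂ (v i) (v i))
      ((-(1 / 4) : ℂ) • ∑ k, ∑ i ∈ F, rankOneComm₂ k (v i) (v i)) := by
  refine ⟨Submodule.sum_mem _ fun i _ => Submodule.subset_span ⟨v i, hv i, v i, hv i, rfl⟩,
    fun k => ∑ i ∈ F, rankOneComm k (v i) (v i), fun k => ∑ i ∈ F, rankOneComm₂ k (v i) (v i),
    fun k => ⟨IsCommutator.sum F fun i _ => ?_, IsCommutator.sum F fun i _ => ?_⟩, rfl⟩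
  · exact isCommutator_rankOne ((hv i).2 k).1 ((hv i).2 k).1
  · exact isCommutator_rankOneComm ((hv i).2 k).1 ((hv i).2 k).2 ((hv i).2 k).1 ((hv i).2 k).2

lemma inClosure_sum_rankOne {ι : Type*} (F : Finset ι) {a : ι → Hilb n}
    (ha : ∀ i k, InDomR k (a i) ∧ InDomR k (obsR k (a i))) :
    InClosure (∑ i ∈ F, rankOne ℂ (a i) (a i))
      ((-(1 / 4) : ℂ) • ∑ k, ∑ i ∈ F, rankOneComm₂ k (a i) (a i)) := by
  choose u hu h0 h1 h2 using fun i => exists_seq_vectorDomain (ha i)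
  refine inClosure_of_traceTendsto (l := atTop)
    (T := fun m => ∑ i ∈ F, rankOne ℂ (u i m) (u i m))
    (U := fun m => (-(1 / 4) : ℂ) • ∑ k, ∑ i ∈ F, rankOneComm₂ k (u i m) (u i m))
    (fun m => (initialGenerator_sum_rankOne F fun i => hu i m).inClosure)
    (traceTendsto_sum F fun i _ => traceTendsto_rankOne (h0 i) (h0 i))
    (TraceTendsto.smul (traceTendsto_sum _ fun k _ => traceTendsto_sum F fun i _ => ?_) _)
  exact ((traceTendsto_rankOne (h2 i k) (h0 i)).sub (traceTendsto_rankOne (h1 i k) (h1 i k))).sub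
    ((traceTendsto_rankOne (h1 i k) (h1 i k)).sub (traceTendsto_rankOne (h0 i) (h2 i k)))

/-- The double commutator of `|a⟩⟨a|` is `|R²a⟩⟨a| - 2 |Ra⟩⟨Ra| + |a⟩⟨R²a|`. Square summability of
the moments makes each of the three series converge in trace norm; `A20`, `A11`, `A02` are their
sums. -/
lemma IsExpansion.mem_generatorDomain {ι : Type*} {ρ : Op n} {a : ι → Hilb n}
    (h : IsExpansion ρ a a) (hdom : ∀ i k, InDomR k (a i) ∧ InDomR k (obsR k (a i)))
    (h0 : Summable fun i => ‖a i‖ ^ 2) (h1 : ∀ k, Summable fun i => ‖obsR k (a i)‖ ^ 2)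
    (h2 : ∀ k, Summable fun i => ‖obsR k (obsR k (a i))‖ ^ 2) : ρ ∈ generatorDomain n := by
  have s20 := fun k => tsum_enorm_mul_lt_top (h2 k) h0
  have s11 := fun k => tsum_enorm_mul_lt_top (h1 k) (h1 k)
  have s02 := fun k => tsum_enorm_mul_lt_top h0 (h2 k)
  have s00 := tsum_enorm_mul_lt_top h0 h0
  choose A20 e20 using fun k => exists_isExpansion_of_tsum_lt_top (s20 k)
  choose A11 e11 using fun k => exists_isExpansion_of_tsum_lt_top (s11 k)
  choose A02 e02 using fun k => exists_isExpansion_of_tsum_lt_top (s02 k)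
  have t20 := fun k => (e20 k).traceNorm_le.trans_lt (s20 k)
  have t11 := fun k => (e11 k).traceNorm_le.trans_lt (s11 k)
  have t02 := fun k => (e02 k).traceNorm_le.trans_lt (s02 k)
  refine ⟨(-(1 / 4) : ℂ) • ∑ k, ((A20 k - A11 k) - (A11 k - A02 k)),
    InClosure.generatorGraph ?_ (h.traceNorm_le.trans_lt s00)
      ((isTraceClass_sum _ _ fun k _ => (IsTraceClass.sub (t20 k) (t11 k)).sub
        (IsTraceClass.sub (t11 k) (t02 k))).smul _)⟩
  refine inClosure_of_traceTendsto (l := atTop) (fun F => inClosure_sum_rankOne F hdom)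
    (h.traceTendsto s00) (TraceTendsto.smul (traceTendsto_sum _ fun k _ => ?_) _)
  simp only [rankOneComm₂, rankOneComm, Finset.sum_sub_distrib]
  exact (((e20 k).traceTendsto (s20 k)).sub ((e11 k).traceTendsto (s11 k))).sub
    (((e11 k).traceTendsto (s11 k)).sub ((e02 k).traceTendsto (s02 k)))

lemma IsSchwartzState.mem_generatorDomain {ρ : Op n} (hρ : IsSchwartzState ρ) :
    ρ ∈ generatorDomain n := by
  obtain ⟨a, hexp, ha⟩ := exists_isExpansion_self hρ.isState.nonneg
  have hs2 : ∑' i, ‖a i‖ₑ ^ 2 < ∞ := by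
    rw [ha, hρ.isState.posTrace_eq_one]
    exact ENNReal.one_lt_top
  have hs := hs2
  simp only [pow_two] at hs
  obtain ⟨f, hf⟩ := hρ.schwartz
  have hc : ∀ k, ContDiff ℝ 4 fun t : ℝ => charFun ρ (t • genDir k) := fun k => by
    simp only [hf]
    exact (f.smooth 4).comp (contDiff_id.smul contDiff_const)
  have key := fun k => hexp.inDomR_and_summable hs k (hc k)
  exact hexp.mem_generatorDomain (fun i k => (key k).1 i)
    (summable_norm_sq_of_tsum_enorm hs2) (fun k => (key k).2.1) fun k => (key k).2.2

end QuantumDiffusion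

end

theorem theorem4p1 (n : ℕ) (hn : 1 ≤ n) :
    ∃ C : ℝ, 0 < C ∧ ∀ ρ : QuantumDiffusion.Op n,
      QuantumDiffusion.IsSchwartzState ρ → QuantumDiffusion.HasPositiveWigner ρ →
        ρ ∈ QuantumDiffusion.generatorDomain n ∧
        (QuantumDiffusion.dirichletForm ρ).im = 0 ∧
        QuantumDiffusion.hsNorm ρ ^ (2 + 2 / (n : ℝ)) ≤
          ENNReal.ofReal (C * (QuantumDiffusion.dirichletForm ρ).re) := by
  obtain ⟨C, hC, h⟩ := QuantumDiffusion.exists_nash_constant n hn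
  exact ⟨C, hC, fun ρ hρ _ => ⟨hρ.mem_generatorDomain, h ρ hρ hρ.mem_generatorDomain⟩⟩
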